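/- Let $G=\mathbb C^*$ and let $V$ be a $G$-module (a finite-dimensional complex vector space with an algebraic linear action of $G$) all of whose weights are $\pm1$. Let $\mathcal O(V)$ be the ring of polynomial functions on $V$, and let $p\colon V\to Z:=V/\!\!/G=\operatorname{Spec}\mathcal O(V)^G$ be the categorical quotient, dual to the inclusion $\mathcal O(V)^G\subseteq\mathcal O(V)$. For an affine $\mathbb C$-scheme $X$ let $X_\infty$ be its arc space, i.e. the affine scheme with $\operatorname{Hom}(\operatorname{Spec}A,X_\infty)=\operatorname{Hom}(\operatorname{Spec}A[[t]],X)$ for all $\mathbb C$-algebras $A$. The group scheme $G_\infty$ acts on $V_\infty$, and $p$ induces a morphism $p_\infty\colon V_\infty\to Z_\infty$. Then the induced homomorphism $$p_\infty^*\colon \mathcal O(Z_\infty)\to\mathcal O(V_\infty)^{G_\infty}$$ is an isomorphism, and $\mathcal O(Z_\infty)$ is an integrally closed domain. -/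

import Mathlib

noncomputable section

namespace ArcSpace

open scoped PowerSeries

universe u v w

section ArcAlgebra

variable (k : Type u) [CommRing k] (R : Type v) [CommRing R] [Algebra k R]

/-- The tautological power series `∑ₙ r⁽ⁿ⁾ tⁿ` attached to `r : R`, whose coefficients are the
variables `r⁽ⁿ⁾ = X (r, n)`. -/
def genericSeries (r : R) : (MvPolynomial (R × ℕ) k)⟦X⟧ :=
  PowerSeries.mk fun n => MvPolynomial.X (r, n)

/-- The polynomials in the variables `r⁽ⁿ⁾` which have to vanish for `r ↦ ∑ₙ r⁽ⁿ⁾ tⁿ` to be a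
homomorphism of `k`-algebras. -/
inductive arcRelations : MvPolynomial (R × ℕ) k → Prop
  | add (r s : R) (n : ℕ) : arcRelations
      (PowerSeries.coeff n (genericSeries k R (r + s) - (genericSeries k R r + genericSeries k R s)))
  | mul (r s : R) (n : ℕ) : arcRelations
      (PowerSeries.coeff n (genericSeries k R (r * s) - genericSeries k R r * genericSeries k R s))
  | scalar (c : k) (n : ℕ) : arcRelations
      (PowerSeries.coeff n (genericSeries k R (algebraMap k R c) -
        PowerSeries.C (MvPolynomial.C c)))

/-- The ideal generated by the defining relations of the arc space. -/
def arcIdeal : Ideal (MvPolynomial (R × ℕ) k) := Ideal.span {p | arcRelations k R p}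

/-- The coordinate ring `𝒪(X_∞)` of the arc space of the affine scheme `X = Spec R` over `k`.
It is the `k`-algebra with `Hom(𝒪(X_∞), A) = Hom(R, A⟦t⟧)` for all `k`-algebras `A`;
see `ArcAlgebra.equiv`. -/
def ArcAlgebra : Type (max u v) := MvPolynomial (R × ℕ) k ⧸ arcIdeal k R

namespace ArcAlgebra

instance : CommRing (ArcAlgebra k R) :=
  inferInstanceAs (CommRing (MvPolynomial (R × ℕ) k ⧸ arcIdeal k R))

instance : Algebra k (ArcAlgebra k R) :=
  inferInstanceAs (Algebra k (MvPolynomial (R × ℕ) k ⧸ arcIdeal k R))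

/-- The quotient homomorphism from the polynomial ring in the variables `r⁽ⁿ⁾`. -/
def mk : MvPolynomial (R × ℕ) k →ₐ[k] ArcAlgebra k R :=
  Ideal.Quotient.mkₐ k (arcIdeal k R)

variable {k R}

lemma mk_eq_zero {p : MvPolynomial (R × ℕ) k} : mk k R p = 0 ↔ p ∈ arcIdeal k R :=
  Ideal.Quotient.eq_zero_iff_mem

lemma mk_surjective : Function.Surjective (mk k R) :=
  Ideal.Quotient.mk_surjective

lemma map_genericSeries_eq {F G : (MvPolynomial (R × ℕ) k)⟦X⟧}
    (h : ∀ n, arcRelations k R (PowerSeries.coeff n (F - G))) :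
    PowerSeries.map (mk k R).toRingHom F = PowerSeries.map (mk k R).toRingHom G := by
  ext n
  have := mk_eq_zero.2 (Ideal.subset_span (h n))
  rw [map_sub, map_sub, sub_eq_zero] at this
  rw [PowerSeries.coeff_map, PowerSeries.coeff_map]
  exact this

lemma map_genericSeries_algebraMap (c : k) :
    PowerSeries.map (mk k R).toRingHom (genericSeries k R (algebraMap k R c)) =
      PowerSeries.C (algebraMap k (ArcAlgebra k R) c) := by
  rw [map_genericSeries_eq (arcRelations.scalar c), PowerSeries.map_C]
  exact congrArg PowerSeries.C ((mk k R).commutes c)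

variable (k R) in
/-- The universal arc `R → 𝒪(X_∞)⟦t⟧`, `r ↦ ∑ₙ r⁽ⁿ⁾ tⁿ`. -/
def universalArc : R →ₐ[k] (ArcAlgebra k R)⟦X⟧ where
  toFun r := PowerSeries.map (mk k R).toRingHom (genericSeries k R r)
  map_one' := by simpa using map_genericSeries_algebraMap (R := R) (1 : k)
  map_mul' r s := by rw [map_genericSeries_eq (arcRelations.mul r s), map_mul]
  map_zero' := by simpa using map_genericSeries_algebraMap (R := R) (0 : k)
  map_add' r s := by rw [map_genericSeries_eq (arcRelations.add r s), map_add]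
  commutes' c := by rw [map_genericSeries_algebraMap, PowerSeries.algebraMap_apply]

lemma coeff_universalArc (r : R) (n : ℕ) :
    PowerSeries.coeff n (universalArc k R r) = mk k R (MvPolynomial.X (r, n)) := by
  change PowerSeries.coeff n (PowerSeries.map (mk k R).toRingHom (genericSeries k R r)) = _
  rw [PowerSeries.coeff_map, genericSeries, PowerSeries.coeff_mk]
  rfl

variable {A : Type w} [CommRing A] [Algebra k A]

/-- The `A`-point of the arc space given by an arc `R → A⟦t⟧`. -/
def lift (γ : R →ₐ[k] A⟦X⟧) : ArcAlgebra k R →ₐ[k] A :=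
  Ideal.Quotient.liftₐ (arcIdeal k R)
    (MvPolynomial.aeval fun p : R × ℕ => PowerSeries.coeff p.2 (γ p.1))
    (by
      have key : ∀ r, PowerSeries.map (MvPolynomial.aeval (R := k)
          fun p : R × ℕ => PowerSeries.coeff p.2 (γ p.1)).toRingHom (genericSeries k R r) = γ r := by
        intro r
        ext n
        simp [genericSeries]
      intro a ha
      change a ∈ RingHom.ker (MvPolynomial.aeval (R := k)
          fun p : R × ℕ => PowerSeries.coeff p.2 (γ p.1)).toRingHom
      revert a
      change arcIdeal k R ≤ _
      refine Ideal.span_le.2 ?_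
      rintro p (⟨r, s, n⟩ | ⟨r, s, n⟩ | ⟨c, n⟩)
      all_goals
        rw [SetLike.mem_coe, RingHom.mem_ker, ← PowerSeries.coeff_map]
        simp only [map_sub, map_add, map_mul, key]
      · simp
      · simp
      · simp [PowerSeries.algebraMap_apply])

lemma lift_mk_X (γ : R →ₐ[k] A⟦X⟧) (r : R) (n : ℕ) :
    lift γ (mk k R (MvPolynomial.X (r, n))) = PowerSeries.coeff n (γ r) := by
  change MvPolynomial.aeval _ _ = _
  simp

lemma hom_ext {f g : ArcAlgebra k R →ₐ[k] A}
    (h : ∀ r n, f (PowerSeries.coeff n (universalArc k R r)) =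
      g (PowerSeries.coeff n (universalArc k R r))) : f = g := by
  have : f.comp (mk k R) = g.comp (mk k R) :=
    MvPolynomial.algHom_ext fun p => by
      simpa only [coeff_universalArc, AlgHom.comp_apply] using h p.1 p.2
  ext x
  obtain ⟨p, rfl⟩ := mk_surjective x
  exact DFunLike.congr_fun this p

/-- The functor of points of the arc space: `Hom(𝒪(X_∞), A) = Hom(R, A⟦t⟧)`. -/
def equiv : (ArcAlgebra k R →ₐ[k] A) ≃ (R →ₐ[k] A⟦X⟧) where
  toFun f := (PowerSeries.mapAlgHom f).comp (universalArc k R)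
  invFun := lift
  left_inv f := by
    refine hom_ext fun r n => ?_
    rw [coeff_universalArc, lift_mk_X, ← coeff_universalArc]
    exact PowerSeries.coeff_map f.toRingHom n _
  right_inv γ := by
    refine AlgHom.ext fun r => PowerSeries.ext fun n => ?_
    rw [← lift_mk_X γ r n, ← coeff_universalArc]
    exact PowerSeries.coeff_map (lift γ).toRingHom n (universalArc k R r)

variable {S : Type w} [CommRing S] [Algebra k S]

/-- The pullback `𝒪(X_∞) → 𝒪(Y_∞)` along `Y_∞ → X_∞`, for a morphism `Y → X` of affine schemes with
pullback `φ : R = 𝒪(X) → S = 𝒪(Y)`. It sends `r⁽ⁿ⁾` to `φ(r)⁽ⁿ⁾`. -/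
def map (φ : R →ₐ[k] S) : ArcAlgebra k R →ₐ[k] ArcAlgebra k S :=
  lift ((universalArc k S).comp φ)

lemma map_coeff_universalArc (φ : R →ₐ[k] S) (r : R) (n : ℕ) :
    map φ (PowerSeries.coeff n (universalArc k R r)) =
      PowerSeries.coeff n (universalArc k S (φ r)) := by
  rw [coeff_universalArc, map, lift_mk_X]
  rfl

end ArcAlgebra

end ArcAlgebra

section Torus

variable (V : Type u) [AddCommGroup V] [Module ℂ V]

/-- The ring `𝒪(V)` of polynomial functions on the vector space `V`. -/
def coordRing : Subalgebra ℂ (V → ℂ) :=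
  Algebra.adjoin ℂ (Set.range fun (ξ : Module.Dual ℂ V) (v : V) => ξ v)

/-- The ring `𝒪(ℂˣ × V)` of regular functions on the variety `ℂˣ × V`. -/
def coordRingProd : Subalgebra ℂ (ℂˣ × V → ℂ) :=
  Algebra.adjoin ℂ
    ({fun p => (p.1 : ℂ), fun p => ((p.1⁻¹ : ℂˣ) : ℂ)} ∪
      Set.range fun (ξ : Module.Dual ℂ V) (p : ℂˣ × V) => ξ p.2)

variable {V}

/-- The representation `ρ` of `ℂˣ` on `V` is algebraic, i.e. `V` is a `ℂˣ`-module: the action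
`ℂˣ × V → V` is a morphism of varieties. -/
def IsAlgebraicRep (ρ : Representation ℂ ℂˣ V) : Prop :=
  ∀ ξ : Module.Dual ℂ V, (fun p : ℂˣ × V => ξ (ρ p.1 p.2)) ∈ coordRingProd V

/-- The integer `m` is a weight of `ρ`: some nonzero `v` satisfies `t · v = t ^ m v` for all
`t : ℂˣ`. -/
def IsWeight (ρ : Representation ℂ ℂˣ V) (m : ℤ) : Prop :=
  ∃ v : V, v ≠ 0 ∧ ∀ t : ℂˣ, ρ t v = ((t ^ m : ℂˣ) : ℂ) • v

/-- The pullback of functions along a map, restricted to subalgebras. -/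
def pullback {P Q : Type*} (a : P → Q) (B : Subalgebra ℂ (Q → ℂ)) (C : Subalgebra ℂ (P → ℂ))
    (h : ∀ f ∈ B, f ∘ a ∈ C) : B →ₐ[ℂ] C where
  toFun f := ⟨(f : Q → ℂ) ∘ a, h f f.2⟩
  map_one' := rfl
  map_mul' _ _ := rfl
  map_zero' := rfl
  map_add' _ _ := rfl
  commutes' _ := rfl

lemma comp_mem_coordRingProd {a : ℂˣ × V → V}
    (h : ∀ ξ : Module.Dual ℂ V, (fun p => ξ (a p)) ∈ coordRingProd V) :
    ∀ f ∈ coordRing V, f ∘ a ∈ coordRingProd V := by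
  intro f hf
  induction hf using Algebra.adjoin_induction with
  | mem f hf =>
    obtain ⟨ξ, rfl⟩ := hf
    exact h ξ
  | algebraMap c => exact (coordRingProd V).algebraMap_mem c
  | add f g _ _ hf hg => exact (coordRingProd V).add_mem hf hg
  | mul f g _ _ hf hg => exact (coordRingProd V).mul_mem hf hg

/-- The pullback `𝒪(V) → 𝒪(ℂˣ × V)` along the action `(t, v) ↦ t · v`. -/
def actionPullback (ρ : Representation ℂ ℂˣ V) (hρ : IsAlgebraicRep ρ) :
    coordRing V →ₐ[ℂ] coordRingProd V :=
  pullback (fun p : ℂˣ × V => ρ p.1 p.2) _ _ (comp_mem_coordRingProd hρ)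

variable (V) in
/-- The pullback `𝒪(V) → 𝒪(ℂˣ × V)` along the projection `(t, v) ↦ v`. -/
def sndPullback : coordRing V →ₐ[ℂ] coordRingProd V :=
  pullback (fun p : ℂˣ × V => p.2) _ _
    (comp_mem_coordRingProd fun ξ => Algebra.subset_adjoin (Or.inr ⟨ξ, rfl⟩))

/-- The ring of invariants `𝒪(V)^G` for `G = ℂˣ`, which is the coordinate ring `𝒪(Z)` of the
categorical quotient `Z = V // G`. -/
def invariants (ρ : Representation ℂ ℂˣ V) : Subalgebra ℂ (coordRing V) where
  carrier := {f | ∀ (t : ℂˣ) (v : V), (f : V → ℂ) (ρ t v) = (f : V → ℂ) v}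
  mul_mem' hf hg t v := congrArg₂ (· * ·) (hf t v) (hg t v)
  add_mem' hf hg t v := congrArg₂ (· + ·) (hf t v) (hg t v)
  algebraMap_mem' _ _ _ := rfl

/-- The ring of invariants `𝒪(V_∞)^{G_∞}` for `G = ℂˣ`. As `(G × V)_∞ = G_∞ × V_∞`, the action and
the projection `G × V → V` induce the action and the projection `G_∞ × V_∞ → V_∞` on arc spaces.
A function on `V_∞` is `G_∞`-invariant if its pullbacks along these two morphisms agree, that is,
if `f(g · v) = f(v)` for all points `g` of `G_∞` and `v` of `V_∞` with values in any
`ℂ`-algebra. -/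
def arcInvariants (ρ : Representation ℂ ℂˣ V) (hρ : IsAlgebraicRep ρ) :
    Subalgebra ℂ (ArcAlgebra ℂ (coordRing V)) :=
  AlgHom.equalizer (ArcAlgebra.map (actionPullback ρ hρ)) (ArcAlgebra.map (sndPullback V))

/-- The pullback `𝒪(Z) = 𝒪(V)^G → 𝒪(V)` of the quotient map `p : V → Z`, i.e. the inclusion. -/
def quotientPullback (ρ : Representation ℂ ℂˣ V) : invariants ρ →ₐ[ℂ] coordRing V :=
  (invariants ρ).val

/-- The pullback `𝒪(Z_∞) → 𝒪(V_∞)` of the morphism `p_∞ : V_∞ → Z_∞` induced by `p`. -/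
def arcPullback (ρ : Representation ℂ ℂˣ V) :
    ArcAlgebra ℂ (invariants ρ) →ₐ[ℂ] ArcAlgebra ℂ (coordRing V) :=
  ArcAlgebra.map (quotientPullback ρ)

lemma arcPullback_mem (ρ : Representation ℂ ℂˣ V) (hρ : IsAlgebraicRep ρ)
    (f : ArcAlgebra ℂ (invariants ρ)) : arcPullback ρ f ∈ arcInvariants ρ hρ := by
  have h : (ArcAlgebra.map (actionPullback ρ hρ)).comp (arcPullback ρ) =
      (ArcAlgebra.map (sndPullback V)).comp (arcPullback ρ) := by
    refine ArcAlgebra.hom_ext fun r n => ?_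
    rw [AlgHom.comp_apply, AlgHom.comp_apply, arcPullback, ArcAlgebra.map_coeff_universalArc,
      ArcAlgebra.map_coeff_universalArc, ArcAlgebra.map_coeff_universalArc]
    have : actionPullback ρ hρ (quotientPullback ρ r) = sndPullback V (quotientPullback ρ r) :=
      Subtype.ext (funext fun p => r.2 p.1 p.2)
    rw [this]
  exact (AlgHom.mem_equalizer _ _ _).2 (DFunLike.congr_fun h f)

/-- The homomorphism `p_∞^* : 𝒪(Z_∞) → 𝒪(V_∞)^{G_∞}`. -/
def arcQuotientPullback (ρ : Representation ℂ ℂˣ V) (hρ : IsAlgebraicRep ρ) :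
    ArcAlgebra ℂ (invariants ρ) →ₐ[ℂ] arcInvariants ρ hρ :=
  (arcPullback ρ).codRestrict (arcInvariants ρ hρ) (arcPullback_mem ρ hρ)

end Torus

end ArcSpace

end

/-! In a basis of weight vectors, `𝒪(V_∞)` is the polynomial ring in the coefficients of series
`x_i(t)`, `y_j(t)`. The ring `S = 𝒪(Z_∞)` is generated by the coefficients of series `z_ij(t)` with
`z_ij z_kl = z_il z_kj`, and the pullback `p` sends `z_ij` to `x_i y_j`. Nothing else about `S` is
used.

Injectivity and surjectivity are proved by duality. A linear functional on the polynomial ring is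
encoded by generating polynomials `Q(u, v)`, which record its values on the coefficients of `∏
x_{i_k}(u_k) ∏ y_{j_l}(v_l)`; cutting by total degree `N` keeps them polynomials. A functional on
`S` is encoded likewise through `∏ z_{i_k j_k}(u_k)`. Composing with `p` restricts `Q` to the loci
where `v` is a permutation of `u`.

Injectivity: every functional on `S` must extend along `p`, so values prescribed on all these loci
must come from one polynomial. On `u_a = u_b` the rank one relation exchanges two of the indices
`j`, so the values for permutations differing by a transposition are congruent modulo `u_a - u_b`.
Newton interpolation (`exists_eval_eq_of_swap_congr`) then gives the polynomial, and averaging makes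
it equivariant.

Surjectivity: `G_∞`-invariants are killed by the vector fields `D_m` of the Lie algebra elements `t
^ m`. If such an `f` is not in the image, some functional kills the image but not `f`. Its `Q`
vanishes on all the loci, hence lies in the ideal of the differences of power sums `p_m(u) - p_m(v)`
(`mem_psumIdeal_of_eval_eq_zero`). Multiplication by such a difference is the transpose of `D_m`, so
the functional is a sum of functionals `ψ_m ∘ D_m` and kills `f` after all.

Normality: the image of `p` is the common kernel of derivations of a polynomial ring, which is
integrally closed. -/

noncomputable section

namespace ArcSpace

universe u

section

open MvPolynomial Finset

/-! ### Newton interpolation on orderings of a finite set -/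

section Interpolation

variable {A α : Type*} [CommRing A] [DecidableEq α]

/-- Modulo `s i - s j` the two evaluation points coincide. -/
lemma dvd_eval_sub_eval_swap {n : ℕ} (s : α → A) (H : MvPolynomial (Fin n) A) (g : Fin n → α)
    (i j : α) : (s i - s j) ∣ eval (s ∘ g) H - eval (s ∘ (Equiv.swap i j ∘ g)) H := by
  rw [← Ideal.mem_span_singleton, ← Ideal.Quotient.eq, ← coe_aeval_eq_eval, ← coe_aeval_eq_eval]
  have hij : Ideal.Quotient.mk (Ideal.span {s i - s j}) (s i) =
      Ideal.Quotient.mk (Ideal.span {s i - s j}) (s j) :=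
    Ideal.Quotient.eq.2 (Ideal.mem_span_singleton_self _)
  have key : ∀ v : Fin n → A, Ideal.Quotient.mk (Ideal.span {s i - s j}) (aeval v H) =
      aeval (fun k => Ideal.Quotient.mk (Ideal.span {s i - s j}) (v k)) H := fun v =>
    comp_aeval_apply v (Ideal.Quotient.mkₐ A (Ideal.span {s i - s j})) H
  change Ideal.Quotient.mk _ (aeval (s ∘ g) H) = Ideal.Quotient.mk _ (aeval _ H)
  rw [key, key]
  congr 2
  funext k
  simp only [Function.comp_apply]
  rcases eq_or_ne (g k) i with h | h
  · rw [h, Equiv.swap_apply_left, hij]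
  rcases eq_or_ne (g k) j with h' | h'
  · rw [h', Equiv.swap_apply_right, hij]
  · rw [Equiv.swap_apply_of_ne_of_ne h h']

/-- Newton interpolation on a complete flag variety: a family `F` of elements of `A`, indexed by
the injections of `Fin n` into `T` and satisfying the congruences of Goresky, Kottwitz and
MacPherson, consists of the values of a polynomial. -/
theorem exists_eval_eq_of_swap_congr [IsDomain A] (s : α → A)
    (hp : ∀ i j, i ≠ j → Prime (s i - s j))
    (hs : ∀ i j k l, i ≠ j → k ≠ l → (s i - s j) ∣ (s k - s l) →
      (k = i ∧ l = j) ∨ (k = j ∧ l = i)) (n : ℕ) :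
    ∀ (T : Finset α) (F : (Fin n → α) → A),
      (∀ g : Fin n → α, Function.Injective g → (∀ k, g k ∈ T) → ∀ i ∈ T, ∀ j ∈ T,
        (s i - s j) ∣ F g - F (Equiv.swap i j ∘ g)) →
      ∃ H : MvPolynomial (Fin n) A, ∀ g : Fin n → α, Function.Injective g → (∀ k, g k ∈ T) →
        eval (s ∘ g) H = F g := by
  induction n with
  | zero =>
    intro T F _
    refine ⟨C (F Fin.elim0), fun g _ _ => ?_⟩
    rw [eval_C]
    congr 1
    exact Subsingleton.elim _ _
  | succ n ih =>
    intro T F hF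
    -- The values allowed for `g 0` serve as Newton nodes: each new node `k` adds a correction that
    -- vanishes at the earlier ones.
    suffices h : ∀ Q ⊆ T, ∃ H : MvPolynomial (Fin (n + 1)) A, ∀ g : Fin (n + 1) → α,
        Function.Injective g → (∀ k, g k ∈ T) → g 0 ∈ Q → eval (s ∘ g) H = F g by
      obtain ⟨H, hH⟩ := h T subset_rfl
      exact ⟨H, fun g hg hT => hH g hg hT (hT 0)⟩
    intro Q
    induction Q using Finset.induction_on with
    | empty => exact fun _ => ⟨0, fun g _ _ h => absurd h (by simp)⟩
    | insert k Q hk ihQ =>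
      intro hQT
      obtain ⟨H, hH⟩ := ihQ ((subset_insert _ _).trans hQT)
      have hkT : k ∈ T := hQT (mem_insert_self _ _)
      have hQmem : ∀ i ∈ Q, i ∈ T := fun i hi => hQT (mem_insert_of_mem hi)
      have hcons : ∀ g : Fin n → α, Function.Injective g → (∀ l, g l ∈ T.erase k) →
          Function.Injective (Fin.cons k g : Fin (n + 1) → α) ∧
            ∀ l, (Fin.cons k g : Fin (n + 1) → α) l ∈ T := by
        intro g hg hgT
        refine ⟨Fin.cons_injective_iff.2 ⟨?_, hg⟩, ?_⟩
        · rintro ⟨l, hl⟩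
          exact (mem_erase.1 (hgT l)).1 hl
        · refine Fin.cases hkT fun l => ?_
          exact (mem_erase.1 (hgT l)).2
      have hswapcons : ∀ (g : Fin n → α) (i j : α), i ≠ k → j ≠ k →
          (Equiv.swap i j ∘ (Fin.cons k g : Fin (n + 1) → α)) =
            Fin.cons k (Equiv.swap i j ∘ g) := by
        intro g i j hi hj
        funext l
        refine Fin.cases ?_ (fun l => ?_) l
        · simp [Equiv.swap_apply_of_ne_of_ne hi.symm hj.symm]
        · simp
      set F' : (Fin (n + 1) → α) → A := fun g => F g - eval (s ∘ g) H with hF'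
      have hF'c : ∀ g : Fin (n + 1) → α, Function.Injective g → (∀ k, g k ∈ T) →
          ∀ i ∈ T, ∀ j ∈ T, (s i - s j) ∣ F' g - F' (Equiv.swap i j ∘ g) := by
        intro g hg hgT i hi j hj
        have := dvd_sub (hF g hg hgT i hi j hj) (dvd_eval_sub_eval_swap s H g i j)
        convert this using 1
        simp only [hF']
        ring
      -- Swapping `k` with `i ∈ Q` moves the first value into `Q`, where `F'` vanishes, so `s k - s
      -- i` divides. These primes are pairwise non-associated, hence their product divides. The
      -- witness `0` for the remaining `g` is a dummy.
      have hdvd : ∀ g : Fin n → α, ∃ c, Function.Injective g → (∀ l, g l ∈ T.erase k) →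
          F' (Fin.cons k g) = (∏ i ∈ Q, (s k - s i)) * c := by
        intro g
        by_cases hg : Function.Injective g ∧ ∀ l, g l ∈ T.erase k
        swap
        · exact ⟨0, fun h1 h2 => absurd ⟨h1, h2⟩ hg⟩
        obtain ⟨hinj, hT⟩ := hcons g hg.1 hg.2
        suffices h : ∏ i ∈ Q, (s k - s i) ∣ F' (Fin.cons k g) by
          obtain ⟨c, hc⟩ := h
          exact ⟨c, fun _ _ => hc⟩
        have : ∀ Q' ⊆ Q, ∏ i ∈ Q', (s k - s i) ∣ F' (Fin.cons k g) := by
          intro Q'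
          induction Q' using Finset.induction_on with
          | empty => simp
          | insert i Q' hi ih' =>
            intro hQ'
            obtain ⟨c, hc⟩ := ih' ((subset_insert _ _).trans hQ')
            have hiQ : i ∈ Q := hQ' (mem_insert_self _ _)
            have hki : k ≠ i := fun h => hk (h ▸ hiQ)
            have h1 := hF'c _ hinj hT k hkT i (hQmem i hiQ)
            have h2 : F' (Equiv.swap k i ∘ (Fin.cons k g : Fin (n + 1) → α)) = 0 := by
              simp only [hF']
              rw [sub_eq_zero, hH]
              · exact (Equiv.swap k i).injective.comp hinj
              · intro l
                simp only [Function.comp_apply]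
                rw [Equiv.swap_apply_def]
                split_ifs
                · exact hQmem i hiQ
                · exact hkT
                · exact hT l
              · simpa using hiQ
            rw [h2, sub_zero, hc] at h1
            rcases (hp k i hki).dvd_or_dvd h1 with h3 | h3
            · obtain ⟨l, hl, h4⟩ := (hp k i hki).exists_mem_finset_dvd h3
              have hlQ : l ∈ Q := hQ' (mem_insert_of_mem hl)
              rcases hs k i k l hki (fun h => hk (h ▸ hlQ)) h4 with h5 | h5
              · exact absurd (h5.2 ▸ hl) hi
              · exact absurd h5.1 hki
            · obtain ⟨e, rfl⟩ := h3
              rw [hc, prod_insert hi]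
              exact ⟨e, by ring⟩
        exact this Q subset_rfl
      choose F'' hF'' using hdvd
      -- The quotient inherits the congruences: for `i, j ≠ k` the prime `s i - s j` divides no
      -- factor `s k - s l`.
      obtain ⟨K, hK⟩ := ih (T.erase k) F'' (by
        intro g hg hgT i hi j hj
        rcases eq_or_ne i j with rfl | hij
        · simp
        have hi' := mem_erase.1 hi
        have hj' := mem_erase.1 hj
        have hg2 : Function.Injective (Equiv.swap i j ∘ g) := (Equiv.swap i j).injective.comp hg
        have hgT2 : ∀ l, (Equiv.swap i j ∘ g) l ∈ T.erase k := by
          intro l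
          simp only [Function.comp_apply]
          rw [Equiv.swap_apply_def]
          split_ifs
          · exact hj
          · exact hi
          · exact hgT l
        obtain ⟨hinj, hT⟩ := hcons g hg hgT
        have h1 := hF'c _ hinj hT i hi'.2 j hj'.2
        rw [hswapcons g i j hi'.1 hj'.1, hF'' g hg hgT, hF'' _ hg2 hgT2, ← mul_sub] at h1
        rcases (hp i j hij).dvd_or_dvd h1 with h3 | h3
        · obtain ⟨l, hl, h4⟩ := (hp i j hij).exists_mem_finset_dvd h3
          rcases hs i j k l hij (fun h => hk (h ▸ hl)) h4 with h5 | h5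
          · exact absurd h5.1.symm hi'.1
          · exact absurd h5.1.symm hj'.1
        · exact h3)
      refine ⟨H + (∏ i ∈ Q, (X 0 - C (s i))) * rename Fin.succ K, fun g hg hgT h0 => ?_⟩
      rw [map_add, map_mul, map_prod, eval_rename]
      simp only [map_sub, eval_X, eval_C, Function.comp_apply]
      by_cases hgQ : g 0 ∈ Q
      · rw [hH g hg hgT hgQ, prod_eq_zero hgQ (sub_self _), zero_mul, add_zero]
      · have h0k : g 0 = k := (mem_insert.1 h0).resolve_right hgQ
        have hgc : g = Fin.cons k (g ∘ Fin.succ) := by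
          rw [← h0k]
          exact (Fin.cons_self_tail g).symm
        have hg1 : Function.Injective (g ∘ Fin.succ) := hg.comp (Fin.succ_injective n)
        have hg2 : ∀ l, (g ∘ Fin.succ) l ∈ T.erase k := fun l =>
          mem_erase.2 ⟨fun h => Fin.succ_ne_zero l (hg (h.trans h0k.symm)), hgT _⟩
        have h6 := hF'' _ hg1 hg2
        rw [← hK _ hg1 hg2, ← hgc] at h6
        rw [h0k, Function.comp_assoc, ← h6, hF']
        ring

end Interpolation

end

section

open MvPolynomial Finset

/-! ### The ideal of differences of power sums -/

section PowerSums

/-- Over a `ℚ`-algebra, the power sums determine the elementary symmetric functions. -/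
lemma aeval_esymm_eq_of_psum_eq {B σ τ : Type*} [CommRing B] [Algebra ℚ B] [Fintype σ] [Fintype τ]
    (a : σ → B) (b : τ → B) (n : ℕ) (h : ∀ m, 0 < m → m ≤ n → ∑ i, a i ^ m = ∑ j, b j ^ m) :
    ∀ k ≤ n, aeval a (esymm σ ℚ k) = aeval b (esymm τ ℚ k) := by
  intro k
  induction k using Nat.strong_induction_on with
  | _ k ih =>
    intro hk
    rcases Nat.eq_zero_or_pos k with rfl | hk0
    · simp
    have ha := congrArg (aeval a) (mul_esymm_eq_sum σ ℚ k)
    have hb := congrArg (aeval b) (mul_esymm_eq_sum τ ℚ k)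
    simp only [map_mul, map_natCast, map_pow, map_neg, map_one, map_sum] at ha hb
    have hab : (k : B) * aeval a (esymm σ ℚ k) = (k : B) * aeval b (esymm τ ℚ k) := by
      rw [ha, hb]
      congr 1
      refine sum_congr rfl fun x hx => ?_
      obtain ⟨h1, h2⟩ := mem_filter.1 hx
      rw [HasAntidiagonal.mem_antidiagonal] at h1
      rw [ih x.1 h2 (h2.le.trans hk)]
      congr 1
      simp only [psum, map_sum, map_pow, aeval_X]
      exact h _ (by omega) (by omega)
    have hunit : IsUnit (k : B) := by
      have : IsUnit ((k : ℚ)) := isUnit_iff_ne_zero.2 (Nat.cast_ne_zero.2 hk0.ne')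
      simpa using this.map (algebraMap ℚ B)
    exact hunit.mul_left_cancel hab

lemma prod_sub_eq_sum_aeval_esymm {B σ : Type*} [CommRing B] [Algebra ℚ B] [Fintype σ]
    (a : σ → B) (x : B) :
    ∏ i, (x - a i) = ∑ j ∈ Finset.range (Fintype.card σ + 1),
      (-1) ^ j * (aeval a (esymm σ ℚ j) * x ^ (Fintype.card σ - j)) := by
  have h := congrArg (Polynomial.eval x)
    (Multiset.prod_X_sub_X_eq_sum_esymm ((univ : Finset σ).val.map a))
  simp only [Multiset.map_map, Multiset.card_map, card_val, card_univ,
    Polynomial.eval_finsetSum, Polynomial.eval_mul, Polynomial.eval_pow, Polynomial.eval_neg,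
    Polynomial.eval_one, Polynomial.eval_C, Polynomial.eval_X,
    ← aeval_esymm_eq_multiset_esymm σ ℚ] at h
  rw [← h]
  change _ = Polynomial.eval x (∏ i, _)
  rw [Polynomial.eval_prod]
  simp

lemma prod_sub_eq_prod_sub_of_psum_eq {B σ τ : Type*} [CommRing B] [Algebra ℚ B] [Fintype σ]
    [Fintype τ] (a : σ → B) (b : τ → B) (n : ℕ) (hσ : Fintype.card σ = n) (hτ : Fintype.card τ = n)
    (h : ∀ m, 0 < m → m ≤ n → ∑ i, a i ^ m = ∑ j, b j ^ m) (x : B) :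
    ∏ i, (x - a i) = ∏ j, (x - b j) := by
  rw [prod_sub_eq_sum_aeval_esymm, prod_sub_eq_sum_aeval_esymm, hσ, hτ]
  refine sum_congr rfl fun j hj => ?_
  rw [aeval_esymm_eq_of_psum_eq a b n h j (by simpa [Nat.lt_succ_iff] using hj)]

variable {A α : Type*} [CommRing A]

/-- The difference of the `m`-th power sums of the `s i`, `i ∈ T`, and of the variables. -/
def psumDiff (s : α → A) (T : Finset α) (n m : ℕ) : MvPolynomial (Fin n) A :=
  C (∑ i ∈ T, s i ^ m) - ∑ l, X l ^ m

/-- Power sums up to `n` suffice, since they determine the `n` elementary symmetric functions. The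
generator with `m = 0` is the constant `T.card - n`, which is zero whenever `T.card = n`. -/
def psumIdeal (s : α → A) (T : Finset α) (n : ℕ) : Ideal (MvPolynomial (Fin n) A) :=
  Ideal.span (Set.range fun m : Fin (n + 1) => psumDiff s T n m)

/-- Modulo the ideal, the `s i` and the variables have equal power sums, hence the same monic
polynomial with these roots; `X 0` is a root of it. -/
lemma prod_X_sub_C_mem_psumIdeal [Algebra ℚ A] (s : α → A) (T : Finset α) (n : ℕ)
    (hT : T.card = n + 1) :
    ∏ i ∈ T, (X 0 - C (s i)) ∈ psumIdeal s T (n + 1) := by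
  rw [← Ideal.Quotient.eq_zero_iff_mem, map_prod, ← prod_coe_sort]
  simp only [map_sub]
  rw [prod_sub_eq_prod_sub_of_psum_eq
    (fun i : T => Ideal.Quotient.mk (psumIdeal s T (n + 1)) (C (s i)))
    (fun l : Fin (n + 1) => Ideal.Quotient.mk (psumIdeal s T (n + 1)) (X l)) (n + 1)
    (by simpa using hT) (by simp) (fun m _ hm => ?_)]
  · exact prod_eq_zero (mem_univ 0) (sub_self _)
  · have h : psumDiff s T (n + 1) m ∈ psumIdeal s T (n + 1) :=
      Ideal.subset_span ⟨⟨m, by omega⟩, rfl⟩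
    rw [← Ideal.Quotient.eq_zero_iff_mem, psumDiff, map_sub, sub_eq_zero] at h
    simp only [map_sum, map_pow] at h
    rw [← h]
    exact sum_coe_sort T fun i => Ideal.Quotient.mk (psumIdeal s T (n + 1)) (C (s i)) ^ m

variable [DecidableEq α]

lemma eval_eq_zero_of_mem_psumIdeal (s : α → A) (T : Finset α) (n : ℕ) (hT : T.card = n)
    {H : MvPolynomial (Fin n) A} (hH : H ∈ psumIdeal s T n) (g : Fin n → α)
    (hg : Function.Injective g) (hgT : ∀ k, g k ∈ T) : eval (s ∘ g) H = 0 := by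
  have himg : univ.image g = T := eq_of_subset_of_card_le
    (fun i hi => by obtain ⟨k, -, rfl⟩ := mem_image.1 hi; exact hgT k)
    (by rw [card_image_of_injective _ hg, hT, card_univ, Fintype.card_fin])
  suffices h : psumIdeal s T n ≤ RingHom.ker (eval (s ∘ g)) from h hH
  refine Ideal.span_le.2 ?_
  rintro _ ⟨m, rfl⟩
  rw [SetLike.mem_coe, RingHom.mem_ker]
  simp only [psumDiff, map_sub, eval_C, map_sum, map_pow, eval_X, Function.comp_apply]
  rw [sub_eq_zero, ← himg, sum_image fun x _ y _ h => hg h]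

/-- The ring `A[u] / (pₘ(s) - pₘ(u))` is reduced, that is, a polynomial vanishing at all orderings
of the family `s` lies in the ideal generated by the differences of power sums. -/
theorem mem_psumIdeal_of_eval_eq_zero [IsDomain A] [Algebra ℚ A] (s : α → A)
    (hs : Function.Injective s) (n : ℕ) :
    ∀ (T : Finset α) (_ : T.card = n) (H : MvPolynomial (Fin n) A),
      (∀ g : Fin n → α, Function.Injective g → (∀ k, g k ∈ T) → eval (s ∘ g) H = 0) →
      H ∈ psumIdeal s T n := by
  induction n with
  | zero =>
    intro T hT H hH
    have h := hH Fin.elim0 (fun k => k.elim0) (fun k => k.elim0)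
    have : H = C (eval (s ∘ Fin.elim0) H) := by
      obtain ⟨a, rfl⟩ := C_surjective (Fin 0) H
      simp
    rw [this, h, map_zero]
    exact zero_mem _
  | succ n ih =>
    intro T hT H hH
    -- Factors `X 0 - C (s i)` are split off one at a time modulo the ideal; once all of `T` is used
    -- up, their product is itself in the ideal.
    suffices h : ∀ Q ⊆ T, ∃ H', H - (∏ i ∈ Q, (X 0 - C (s i))) * H' ∈ psumIdeal s T (n + 1) by
      obtain ⟨H', hH'⟩ := h T subset_rfl
      have := Ideal.mul_mem_right H' _ (prod_X_sub_C_mem_psumIdeal s T n hT)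
      simpa using add_mem hH' this
    intro Q
    induction Q using Finset.induction_on with
    | empty => exact fun _ => ⟨H, by simp⟩
    | insert k Q hk ihQ =>
      intro hQT
      obtain ⟨H', hH'⟩ := ihQ ((subset_insert _ _).trans hQT)
      have hkT : k ∈ T := hQT (mem_insert_self _ _)
      set K : MvPolynomial (Fin n) A := aeval (Fin.cons (C (s k)) X : Fin (n + 1) → _) H' with hKdef
      -- At orderings that start with `k ∉ Q` the product over `Q` is nonzero, as `s` is injective,
      -- so `H'` itself vanishes there.
      have hK : K ∈ psumIdeal s (T.erase k) n := by
        refine ih _ (by rw [card_erase_of_mem hkT, hT]; rfl) _ fun g hg hgT => ?_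
        have hinj : Function.Injective (Fin.cons k g : Fin (n + 1) → α) := by
          refine Fin.cons_injective_iff.2 ⟨?_, hg⟩
          rintro ⟨l, hl⟩
          exact (mem_erase.1 (hgT l)).1 hl
        have hgT' : ∀ l, (Fin.cons k g : Fin (n + 1) → α) l ∈ T :=
          Fin.cases hkT fun l => (mem_erase.1 (hgT l)).2
        have h1 := eval_eq_zero_of_mem_psumIdeal s T (n + 1) hT hH' _ hinj hgT'
        rw [map_sub, hH _ hinj hgT', zero_sub, neg_eq_zero, map_mul, map_prod] at h1
        rcases mul_eq_zero.1 h1 with h2 | h2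
        · obtain ⟨i, hi, h3⟩ := prod_eq_zero_iff.1 h2
          simp only [map_sub, eval_X, eval_C, Function.comp_apply, Fin.cons_zero, sub_eq_zero] at h3
          exact absurd (hs h3 ▸ hi) hk
        · rw [hKdef, ← coe_aeval_eq_eval, ← h2, ← coe_aeval_eq_eval, RingHom.coe_coe,
            RingHom.coe_coe, comp_aeval_apply]
          congr 2
          funext l
          refine Fin.cases ?_ (fun l => ?_) l <;> simp
      set J : Ideal (MvPolynomial (Fin (n + 1)) A) :=
        psumIdeal s T (n + 1) ⊔ Ideal.span {X 0 - C (s k)} with hJ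
      have hX0 : Ideal.Quotient.mk J (X 0) = Ideal.Quotient.mk J (C (s k)) :=
        Ideal.Quotient.eq.2 (Ideal.mem_sup_right (Ideal.mem_span_singleton_self _))
      -- Modulo `X 0 - C (s k)` the terms of `k` and of `X 0` cancel, which turns the generators for
      -- `T` into those for `T.erase k`.
      have hren : rename Fin.succ K ∈ J := by
        suffices h : psumIdeal s (T.erase k) n ≤ J.comap (rename Fin.succ (R := A)) from h hK
        refine Ideal.span_le.2 ?_
        rintro _ ⟨m, rfl⟩
        rw [SetLike.mem_coe, Ideal.mem_comap]
        have h1 : psumDiff s T (n + 1) m ∈ J := Ideal.mem_sup_left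
          (Ideal.subset_span ⟨m.castSucc, rfl⟩)
        rw [← Ideal.Quotient.eq_zero_iff_mem] at h1 ⊢
        rw [← h1]
        simp only [psumDiff, map_sub, map_sum, map_pow, rename_X, rename_C, Fin.sum_univ_succ,
          ← add_sum_erase T _ hkT, hX0, map_add]
        ring
      have hsub : H' - rename Fin.succ K ∈ J := by
        rw [← Ideal.Quotient.eq, hKdef]
        change Ideal.Quotient.mkₐ A J H' = Ideal.Quotient.mkₐ A J (rename Fin.succ _)
        rw [comp_aeval_apply, comp_aeval_apply]
        conv_lhs => rw [← aeval_X_left_apply H', comp_aeval_apply]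
        congr 2
        funext l
        refine Fin.cases ?_ (fun l => ?_) l
        · simp only [Fin.cons_zero, algHom_C]
          exact hX0
        · simp
      have hH'J : H' ∈ J := by simpa using add_mem hsub hren
      obtain ⟨a, ha, b, hb, hab⟩ := Submodule.mem_sup.1 hH'J
      obtain ⟨c, rfl⟩ := Ideal.mem_span_singleton'.1 hb
      refine ⟨c, ?_⟩
      have := add_mem hH' (Ideal.mul_mem_left _ (∏ i ∈ Q, (X 0 - C (s i))) ha)
      convert this using 1
      rw [prod_insert hk, ← hab]
      ring

end PowerSums

end

section

open MvPolynomial Finset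

/-! ### Differences of variables as primes -/

section Differences

variable {K R : Type*} [CommRing R] [DecidableEq K]

/-- Every polynomial is congruent modulo `X i - X j` to its image under `X i ↦ X j`, so the
difference generates the kernel of this substitution. Primality follows, as the target is a domain.
-/
lemma X_sub_X_dvd_iff (i j : K) (f : MvPolynomial K R) :
    (X i - X j) ∣ f ↔ rename (Function.update id i j) f = 0 := by
  have h1 : rename (Function.update id i j) (X i - X j : MvPolynomial K R) = 0 := by
    rw [map_sub, rename_X, rename_X, Function.update_self]
    rcases eq_or_ne j i with rfl | h
    · simp
    · rw [Function.update_of_ne h, id, sub_self]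
  refine ⟨?_, fun h => ?_⟩
  · rintro ⟨g, rfl⟩
    rw [map_mul, h1, zero_mul]
  · have h2 : ∀ g : MvPolynomial K R, (X i - X j) ∣ g - rename (Function.update id i j) g := by
      intro g
      rw [← Ideal.mem_span_singleton, ← Ideal.Quotient.eq]
      change (Ideal.Quotient.mkₐ R _) g = ((Ideal.Quotient.mkₐ R _).comp (rename _)) g
      congr 1
      refine algHom_ext fun k => ?_
      rw [AlgHom.comp_apply, rename_X]
      rcases eq_or_ne k i with rfl | hk
      · rw [Function.update_self]
        exact Ideal.Quotient.eq.2 (Ideal.mem_span_singleton_self _)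
      · rw [Function.update_of_ne hk, id]
    simpa [h] using h2 f

lemma prime_X_sub_X [IsDomain R] {i j : K} (h : i ≠ j) :
    Prime (X i - X j : MvPolynomial K R) := by
  refine ⟨sub_ne_zero.2 fun e => h (X_injective e), fun hu => ?_, fun a b hab => ?_⟩
  · have h1 := (isUnit_iff_dvd_one.1 hu)
    rw [X_sub_X_dvd_iff, map_one] at h1
    exact one_ne_zero h1
  · rw [X_sub_X_dvd_iff, map_mul, mul_eq_zero] at hab
    simpa only [X_sub_X_dvd_iff] using hab

lemma eq_of_X_sub_X_dvd_X_sub_X [Nontrivial R] {i j k l : K} (hij : i ≠ j) (hkl : k ≠ l)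
    (h : (X i - X j : MvPolynomial K R) ∣ X k - X l) : (k = i ∧ l = j) ∨ (k = j ∧ l = i) := by
  rw [X_sub_X_dvd_iff, map_sub, rename_X, rename_X, sub_eq_zero] at h
  have h' := X_injective h
  rcases eq_or_ne k i with rfl | hk
  · rw [Function.update_self, Function.update_of_ne hkl.symm] at h'
    exact Or.inl ⟨rfl, h'.symm⟩
  · rcases eq_or_ne l i with rfl | hl
    · rw [Function.update_self, Function.update_of_ne hk] at h'
      exact Or.inr ⟨h', rfl⟩
    · rw [Function.update_of_ne hk, Function.update_of_ne hl] at h'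
      exact absurd h' hkl

end Differences

/-! ### Generating polynomials of linear functionals -/

section GeneratingPolynomial

variable {S : Type*} [CommRing S] {K K' : Type*}

section WeightPart

variable [Fintype K] [Fintype K']

/-- The coefficient of `ε ^ N` in `∏ k, f k (ε X_k)`. -/
def weightPart (N : ℕ) (f : K → PowerSeries S) : MvPolynomial K S :=
  PowerSeries.coeff N (∏ k, PowerSeries.rescale (X k : MvPolynomial K S)
    (PowerSeries.map (C : S →+* MvPolynomial K S) (f k)))

lemma coeff_weightPart (N : ℕ) (f : K → PowerSeries S) (n : K →₀ ℕ) :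
    coeff n (weightPart N f) =
      if n.degree = N then ∏ k, PowerSeries.coeff (n k) (f k) else 0 := by
  classical
  rw [weightPart, PowerSeries.coeff_prod, coeff_sum]
  have h1 : ∀ l : K →₀ ℕ, ∏ k, PowerSeries.coeff (l k) (PowerSeries.rescale (X k : MvPolynomial K S)
      (PowerSeries.map (C : S →+* MvPolynomial K S) (f k))) =
      monomial l (∏ k, PowerSeries.coeff (l k) (f k)) := by
    intro l
    simp only [PowerSeries.coeff_rescale, PowerSeries.coeff_map, prod_mul_distrib, ← map_prod]
    rw [monomial_eq, Finsupp.prod_fintype _ _ (fun _ => pow_zero _), mul_comm]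
  simp only [h1, coeff_monomial]
  rw [sum_ite_eq']
  simp only [mem_finsuppAntidiag, subset_univ, and_true, Finsupp.degree_eq_sum]

/-- Series evaluated at variables that become equal multiply to one series in the common variable.
Thus relations between the series turn into identities on diagonals. -/
lemma rename_weightPart [DecidableEq K'] (r : K → K') (N : ℕ) (f : K → PowerSeries S) :
    rename r (weightPart N f) = weightPart N fun k' => ∏ k with r k = k', f k := by
  have h1 : ∀ F : PowerSeries (MvPolynomial K S), rename r (PowerSeries.coeff N F) =
      PowerSeries.coeff N (PowerSeries.map (rename r : _ →ₐ[S] MvPolynomial K' S).toRingHom F) :=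
    fun F => (PowerSeries.coeff_map _ _ _).symm
  rw [weightPart, weightPart, h1, map_prod]
  congr 1
  have h2 : ∀ (k : K), PowerSeries.map (rename r : _ →ₐ[S] MvPolynomial K' S).toRingHom
      (PowerSeries.rescale (X k : MvPolynomial K S)
        (PowerSeries.map (C : S →+* MvPolynomial K S) (f k))) =
      PowerSeries.rescale (X (r k) : MvPolynomial K' S)
        (PowerSeries.map (C : S →+* MvPolynomial K' S) (f k)) := by
    intro k
    ext1 n
    rw [PowerSeries.coeff_map, PowerSeries.coeff_rescale, PowerSeries.coeff_rescale,
      PowerSeries.coeff_map, PowerSeries.coeff_map]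
    change rename r _ = _
    rw [map_mul, map_pow, rename_X, rename_C]
  simp only [h2, map_prod]
  rw [← prod_fiberwise univ r]
  refine prod_congr rfl fun k' _ => prod_congr rfl fun k hk => ?_
  rw [(mem_filter.1 hk).2]

end WeightPart

variable [Algebra ℂ S]

/-- The linear map on polynomials applying a linear functional to the coefficients. -/
def mapCoeff (φ : S →ₗ[ℂ] ℂ) (p : MvPolynomial K S) : MvPolynomial K ℂ :=
  ∑ n ∈ p.support, monomial n (φ (coeff n p))

lemma coeff_mapCoeff (φ : S →ₗ[ℂ] ℂ) (p : MvPolynomial K S) (n : K →₀ ℕ) :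
    coeff n (mapCoeff φ p) = φ (coeff n p) := by
  classical
  rw [mapCoeff, coeff_sum]
  simp only [coeff_monomial, sum_ite_eq', mem_support_iff]
  split_ifs with h
  · rfl
  · rw [not_not.1 h, map_zero]

lemma mapCoeff_monomial (φ : S →ₗ[ℂ] ℂ) (n : K →₀ ℕ) (a : S) :
    mapCoeff φ (monomial n a) = monomial n (φ a) := by
  classical
  ext m
  rw [coeff_mapCoeff, coeff_monomial, coeff_monomial, apply_ite φ, map_zero]

lemma mapCoeff_add (φ : S →ₗ[ℂ] ℂ) (p q : MvPolynomial K S) :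
    mapCoeff φ (p + q) = mapCoeff φ p + mapCoeff φ q := by
  ext m
  simp only [coeff_mapCoeff, coeff_add, map_add]

lemma rename_mapCoeff (φ : S →ₗ[ℂ] ℂ) (r : K → K') (p : MvPolynomial K S) :
    rename r (mapCoeff φ p) = mapCoeff φ (rename r p) := by
  induction p using MvPolynomial.monomial_add_induction_on with
  | C a =>
    rw [rename_C, ← monomial_zero', ← monomial_zero', mapCoeff_monomial, mapCoeff_monomial,
      rename_monomial, Finsupp.mapDomain_zero]
  | monomial_add n a p _ _ ih =>
    rw [mapCoeff_add, map_add, map_add, mapCoeff_add, ih, rename_monomial, mapCoeff_monomial,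
      mapCoeff_monomial, rename_monomial]

variable [Fintype K] [Fintype K']

/-- The generating polynomial of the values of the linear functional `φ` on the products of
coefficients of the power series `f k`, with total weight `N`. -/
def genPoly (φ : S →ₗ[ℂ] ℂ) (N : ℕ) (f : K → PowerSeries S) : MvPolynomial K ℂ :=
  mapCoeff φ (weightPart N f)

lemma coeff_genPoly (φ : S →ₗ[ℂ] ℂ) (N : ℕ) (f : K → PowerSeries S) (n : K →₀ ℕ) :
    coeff n (genPoly φ N f) =
      if n.degree = N then φ (∏ k, PowerSeries.coeff (n k) (f k)) else 0 := by
  rw [genPoly, coeff_mapCoeff, coeff_weightPart, apply_ite φ, map_zero]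

lemma rename_genPoly [DecidableEq K'] (φ : S →ₗ[ℂ] ℂ) (r : K → K') (N : ℕ)
    (f : K → PowerSeries S) :
    rename r (genPoly φ N f) = genPoly φ N fun k' => ∏ k with r k = k', f k := by
  rw [genPoly, rename_mapCoeff, rename_weightPart, genPoly]

lemma rename_equiv_genPoly (φ : S →ₗ[ℂ] ℂ) (r : K ≃ K') (N : ℕ) (f : K → PowerSeries S) :
    rename r (genPoly φ N f) = genPoly φ N fun k' => f (r.symm k') := by
  classical
  rw [rename_genPoly]
  congr 1
  funext k'
  rw [prod_eq_single (r.symm k')]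
  · intro k hk h
    exact absurd ((r.symm_apply_eq).2 (mem_filter.1 hk).2.symm).symm h
  · simp

end GeneratingPolynomial

end

section

open MvPolynomial Finset

/-! ### Restriction to the loci where `v` is a permutation of `u` -/

section Flags

variable {S : Type*} [CommRing S] [Algebra ℂ S]

/-- On `u_a = u_b` only the product of the factors at `a` and `b` matters, and the rank one relation
makes it insensitive to exchanging their second indices. This is the congruence that interpolation
requires. -/
lemma exists_rename_eq_genPoly {ι κ : Type*} {z : ι → κ → PowerSeries S}
    (hz : ∀ i j k l, z i j * z k l = z i l * z k j) (φ : S →ₗ[ℂ] ℂ) {d : ℕ} (i : Fin d → ι)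
    (j : Fin d → κ) (N : ℕ) :
    ∃ H : MvPolynomial (Fin d ⊕ Fin d) ℂ, ∀ σ : Equiv.Perm (Fin d),
      rename (Sum.elim id σ) H = genPoly φ N fun k => z (i k) (j (σ.symm k)) := by
  obtain ⟨H, hH⟩ := exists_eval_eq_of_swap_congr (A := MvPolynomial (Fin d) ℂ) X
    (fun _ _ => prime_X_sub_X) (fun _ _ _ _ => eq_of_X_sub_X_dvd_X_sub_X) d univ
    -- For injective, hence bijective, `g` this is `j (g⁻¹ k)`; the default value of
    -- `Function.extend` plays no role.
    (fun g => genPoly φ N fun k => z (i k) (Function.extend g j j k)) (by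
      intro g hg _ a _ b _
      rcases eq_or_ne a b with rfl | hab
      · simp only [Equiv.swap_self, Equiv.coe_refl, Function.id_comp, sub_self]
        exact dvd_zero _
      have hJ : ∀ k, Function.extend (Equiv.swap a b ∘ g) j j k =
          Function.extend g j j (Equiv.swap a b k) := by
        intro k
        obtain ⟨l, hl⟩ := Finite.surjective_of_injective hg (Equiv.swap a b k)
        have hk : k = (Equiv.swap a b ∘ g) l := by
          rw [Function.comp_apply, hl, Equiv.swap_apply_self]
        rw [← hl, hg.extend_apply]
        conv_lhs => rw [hk]
        rw [((Equiv.swap a b).injective.comp hg).extend_apply]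
      rw [X_sub_X_dvd_iff, map_sub, sub_eq_zero, rename_genPoly, rename_genPoly]
      congr 1
      funext k'
      by_cases hk' : k' = b
      · subst hk'
        have : (univ.filter fun k => Function.update id a k' k = k') = {a, k'} := by
          ext k
          rcases eq_or_ne k a with rfl | hk
          · simp
          · simp [hk]
        rw [this, prod_pair hab, prod_pair hab, hJ, hJ, Equiv.swap_apply_left,
          Equiv.swap_apply_right]
        exact hz _ _ _ _
      · refine prod_congr rfl fun k hk => ?_
        have h1 := (mem_filter.1 hk).2
        have hka : k ≠ a := by
          rintro rfl
          rw [Function.update_self] at h1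
          exact hk' h1.symm
        have hkb : k ≠ b := by
          rintro rfl
          rw [Function.update_of_ne hka] at h1
          exact hk' h1.symm
        rw [hJ, Equiv.swap_apply_of_ne_of_ne hka hkb])
  refine ⟨eval₂ (rename Sum.inl : MvPolynomial (Fin d) ℂ →ₐ[ℂ] _).toRingHom
    (fun l => X (Sum.inr l)) H, fun σ => ?_⟩
  have h1 := hH σ σ.injective (fun _ => mem_univ _)
  change (rename (Sum.elim id σ) : _ →ₐ[ℂ] MvPolynomial (Fin d) ℂ).toRingHom _ = _
  rw [hom_eval₂]
  have h2 : ((rename (Sum.elim id σ) : _ →ₐ[ℂ] MvPolynomial (Fin d) ℂ).toRingHom.comp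
      (rename Sum.inl : MvPolynomial (Fin d) ℂ →ₐ[ℂ] _).toRingHom) = RingHom.id _ := by
    refine RingHom.ext fun p => ?_
    change rename _ (rename _ p) = p
    rw [rename_rename]
    exact rename_id_apply p
  have h3 : (fun l : Fin d => (rename (Sum.elim id σ) : _ →ₐ[ℂ] MvPolynomial (Fin d) ℂ).toRingHom
      (X (Sum.inr l))) = X ∘ σ := by
    funext l
    change rename _ (X _) = _
    rw [rename_X]
    rfl
  have h4 : (eval₂ (RingHom.id (MvPolynomial (Fin d) ℂ)) (X ∘ σ) H) = eval (X ∘ σ) H := rfl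
  rw [h2]
  erw [h3]
  rw [h4, h1]
  congr 1
  funext k
  congr 1
  conv_lhs => rw [← σ.apply_symm_apply k]
  rw [σ.injective.extend_apply]

/-- View `Q` as a polynomial in `v` over the domain `ℂ[u]`: it vanishes at all orderings of the
`u_k`. The coefficients `K m` are extended by zero so that any longer range of `m` may be used. -/
lemma exists_eq_sum_of_rename_eq_zero {d : ℕ} (Q : MvPolynomial (Fin d ⊕ Fin d) ℂ)
    (hQ : ∀ σ : Equiv.Perm (Fin d), rename (Sum.elim id σ) Q = 0) :
    ∃ K : ℕ → MvPolynomial (Fin d ⊕ Fin d) ℂ, (∀ m, d < m → K m = 0) ∧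
      Q = ∑ m ∈ range (d + 1),
        K m * (∑ k, X (Sum.inl k) ^ m - ∑ l, X (Sum.inr l) ^ m) := by
  set H : MvPolynomial (Fin d) (MvPolynomial (Fin d) ℂ) :=
    aeval (Sum.elim (fun k => C (X k)) X) Q with hHdef
  have hH : H ∈ psumIdeal X univ d := by
    refine mem_psumIdeal_of_eval_eq_zero X (X_injective) d univ (by simp) H fun g hg _ => ?_
    rw [← hQ (Equiv.ofBijective g (Finite.injective_iff_bijective.1 hg)), hHdef]
    change (((aeval (R := MvPolynomial (Fin d) ℂ) (X ∘ g)).restrictScalars ℂ).comp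
      (aeval (Sum.elim (fun k => C (X k)) X))) Q = _
    congr 1
    refine algHom_ext fun k => ?_
    rcases k with k | k <;> simp
  rw [psumIdeal, Ideal.mem_span_range_iff_exists_fun] at hH
  obtain ⟨c, hc⟩ := hH
  set B : MvPolynomial (Fin d) (MvPolynomial (Fin d) ℂ) →+* MvPolynomial (Fin d ⊕ Fin d) ℂ :=
    eval₂Hom (rename Sum.inl : MvPolynomial (Fin d) ℂ →ₐ[ℂ] _).toRingHom
      (fun l => X (Sum.inr l)) with hB
  have hBC : ∀ p, B (C p) = rename Sum.inl p := fun p => eval₂Hom_C _ _ _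
  have hBX : ∀ k, B (X k) = X (Sum.inr k) := fun p => eval₂Hom_X' _ _ _
  have hBH : B H = Q := by
    have : (B.comp (aeval (R := ℂ) (Sum.elim (fun k => C (X k)) X)).toRingHom) =
        RingHom.id (MvPolynomial (Fin d ⊕ Fin d) ℂ) := by
      refine ringHom_ext (fun a => ?_) fun k => ?_
      · change B (aeval _ (C a)) = C a
        rw [aeval_C]
        change B (C (C a)) = C a
        rw [hBC, rename_C]
      · change B (aeval _ (X k)) = X k
        rw [aeval_X]
        rcases k with k | k
        · rw [Sum.elim_inl, hBC, rename_X]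
        · rw [Sum.elim_inr, hBX]
    exact DFunLike.congr_fun this Q
  refine ⟨fun m => if h : m < d + 1 then B (c ⟨m, h⟩) else 0, fun m hm => ?_, ?_⟩
  · exact dif_neg (by omega)
  · rw [← hBH, ← hc, map_sum, ← Fin.sum_univ_eq_sum_range
      (fun m => (if h : m < d + 1 then B (c ⟨m, h⟩) else 0) *
        (∑ k, X (Sum.inl k) ^ m - ∑ l, X (Sum.inr l) ^ m))]
    refine sum_congr rfl fun m _ => ?_
    rw [dif_pos m.2, map_mul, psumDiff]
    simp only [map_sub, map_sum, map_pow, hBC, hBX, rename_X]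

end Flags

/-! ### Functionals from equivariant families of polynomials -/

section Functionals

variable {ι κ : Type*}

lemma prod_X_eq_monomial {L K R : Type*} [CommRing R] [Fintype K] (v : K → L) :
    (∏ k, X (v k) : MvPolynomial L R) = monomial (∑ k, Finsupp.single (v k) 1) 1 := by
  rw [monomial_sum_one]
  rfl

lemma exists_equiv_of_prod_X_eq {L K K' R : Type*} [CommRing R] [Nontrivial R] [Fintype K]
    [Fintype K'] (v : K → L) (v' : K' → L)
    (h : (∏ k, X (v k) : MvPolynomial L R) = ∏ k, X (v' k)) :
    ∃ e : K ≃ K', ∀ k, v' (e k) = v k := by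
  classical
  rw [prod_X_eq_monomial, prod_X_eq_monomial, monomial_left_inj one_ne_zero] at h
  have h2 : ∀ c, Fintype.card {k // v k = c} = Fintype.card {k // v' k = c} := by
    intro c
    have := DFunLike.congr_fun h c
    simpa [Finsupp.finsetSum_apply, Finsupp.single_apply, Fintype.card_subtype] using this
  exact ⟨Equiv.ofFiberEquiv fun c => Fintype.equivOfCardEq (h2 c),
    fun k => Equiv.ofFiberEquiv_map _ k⟩

/-- The monomial in the coordinates `x_i⁽ⁿ⁾`, `y_j⁽ⁿ⁾` of the arc space of a vector space. -/
def arcMonomial {d e : ℕ} (i : Fin d → ι) (j : Fin e → κ) (n : Fin d ⊕ Fin e →₀ ℕ) :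
    MvPolynomial ((ι ⊕ κ) × ℕ) ℂ :=
  ∏ k, X (Sum.map i j k, n k)

lemma span_arcMonomial_eq_top :
    Submodule.span ℂ {p : MvPolynomial ((ι ⊕ κ) × ℕ) ℂ |
      ∃ (d e : ℕ) (i : Fin d → ι) (j : Fin e → κ) (n : _), p = arcMonomial i j n} = ⊤ := by
  rw [eq_top_iff]
  rintro p -
  induction p using MvPolynomial.induction_on with
  | C a =>
    rw [← mul_one (C a), ← smul_eq_C_mul]
    refine Submodule.smul_mem _ _ (Submodule.subset_span
      ⟨0, 0, Fin.elim0, Fin.elim0, 0, ?_⟩)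
    simp [arcMonomial]
  | add p q hp hq => exact add_mem hp hq
  | mul_X p c hp =>
    induction hp using Submodule.span_induction with
    | zero => simp
    | add p q _ _ hp hq =>
      rw [add_mul]
      exact add_mem hp hq
    | smul a p _ hp =>
      rw [smul_mul_assoc]
      exact Submodule.smul_mem _ _ hp
    | mem p hp =>
      obtain ⟨d, e, i, j, n, rfl⟩ := hp
      refine Submodule.subset_span ?_
      obtain ⟨a | b, m⟩ := c
      · refine ⟨d + 1, e, Fin.cons a i, j, Finsupp.equivFunOnFinite.symm
          (Sum.elim (Fin.cons m fun k => n (Sum.inl k)) fun k => n (Sum.inr k)), ?_⟩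
        simp only [arcMonomial, Fintype.prod_sum_type, Fin.prod_univ_succ, Sum.map_inl,
          Sum.map_inr, Fin.cons_zero, Fin.cons_succ, Finsupp.equivFunOnFinite_symm_apply_apply,
          Sum.elim_inl, Sum.elim_inr]
        ring
      · refine ⟨d, e + 1, i, Fin.cons b j, Finsupp.equivFunOnFinite.symm
          (Sum.elim (fun k => n (Sum.inl k)) (Fin.cons m fun k => n (Sum.inr k))), ?_⟩
        simp only [arcMonomial, Fintype.prod_sum_type, Fin.prod_univ_succ, Sum.map_inl,
          Sum.map_inr, Fin.cons_zero, Fin.cons_succ, Finsupp.equivFunOnFinite_symm_apply_apply,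
          Sum.elim_inl, Sum.elim_inr]
        ring

/-- Setting all `y` variables to `1`, respectively all `x` variables, yields the two permutations
separately. -/
lemma exists_perm_of_arcMonomial_eq {d e d' e' : ℕ} {i : Fin d → ι} {j : Fin e → κ}
    {i' : Fin d' → ι} {j' : Fin e' → κ} {n : Fin d ⊕ Fin e →₀ ℕ} {n' : Fin d' ⊕ Fin e' →₀ ℕ}
    (h : arcMonomial i j n = arcMonomial i' j' n') :
    ∃ (σ : Fin d ≃ Fin d') (τ : Fin e ≃ Fin e'), i' ∘ σ = i ∧ j' ∘ τ = j ∧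
      n' = n.mapDomain (Sum.map σ τ) := by
  have h1 := congrArg (aeval (R := ℂ) fun c : (ι ⊕ κ) × ℕ =>
    Sum.elim (fun a => (X (a, c.2) : MvPolynomial (ι × ℕ) ℂ)) (fun _ => 1) c.1) h
  have h2 := congrArg (aeval (R := ℂ) fun c : (ι ⊕ κ) × ℕ =>
    Sum.elim (fun _ => 1) (fun b => (X (b, c.2) : MvPolynomial (κ × ℕ) ℂ)) c.1) h
  simp only [arcMonomial, map_mul, map_prod, aeval_X, Fintype.prod_sum_type, Sum.map_inl, Sum.map_inr,
    Sum.elim_inl, Sum.elim_inr, prod_const_one, mul_one, one_mul] at h1 h2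
  obtain ⟨σ, hσ⟩ := exists_equiv_of_prod_X_eq _ _ h1
  obtain ⟨τ, hτ⟩ := exists_equiv_of_prod_X_eq _ _ h2
  refine ⟨σ, τ, funext fun k => congrArg Prod.fst (hσ k), funext fun k => congrArg Prod.fst (hτ k),
    ?_⟩
  have hinj : Function.Injective (Sum.map σ τ) := σ.injective.sumMap τ.injective
  ext k
  obtain ⟨k, rfl⟩ := (Function.Surjective.sumMap σ.surjective τ.surjective) k
  rw [Finsupp.mapDomain_apply hinj]
  rcases k with k | k
  · exact congrArg Prod.snd (hσ k)
  · exact congrArg Prod.snd (hτ k)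

/-- A family of polynomials which is equivariant under permutations consists of the generating
polynomials of a linear functional. -/
theorem exists_functional_arcMonomial
    (H : ∀ d e : ℕ, (Fin d → ι) → (Fin e → κ) → ℕ → MvPolynomial (Fin d ⊕ Fin e) ℂ)
    (hH : ∀ d e i j N (σ : Equiv.Perm (Fin d)) (τ : Equiv.Perm (Fin e)),
      rename (Sum.map σ τ) (H d e (i ∘ σ) (j ∘ τ) N) = H d e i j N) :
    ∃ ψ : MvPolynomial ((ι ⊕ κ) × ℕ) ℂ →ₗ[ℂ] ℂ, ∀ d e i j n,
      ψ (arcMonomial i j n) = coeff n (H d e i j n.degree) := by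
  classical
  -- A monomial has several presentations by `(d, e, i, j, n)`. They differ by permutations, so
  -- equivariance makes the prescribed value independent of the choice.
  have hwd : ∀ s : ((ι ⊕ κ) × ℕ) →₀ ℕ, ∃ a : ℂ, ∀ d e i j n,
      arcMonomial i j n = monomial s 1 → a = coeff n (H d e i j n.degree) := by
    intro s
    by_cases hs : ∃ (d e : ℕ) (i : Fin d → ι) (j : Fin e → κ) (n : _),
      arcMonomial i j n = monomial s 1
    swap
    · exact ⟨0, fun d e i j n h => absurd ⟨d, e, i, j, n, h⟩ hs⟩
    obtain ⟨d, e, i, j, n, h⟩ := hs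
    refine ⟨coeff n (H d e i j n.degree), fun d' e' i' j' n' h' => ?_⟩
    obtain ⟨σ, τ, rfl, rfl, rfl⟩ := exists_perm_of_arcMonomial_eq (h.trans h'.symm)
    obtain rfl : d = d' := by simpa using Fintype.card_congr σ
    obtain rfl : e = e' := by simpa using Fintype.card_congr τ
    have hdeg : (n.mapDomain (Sum.map σ τ)).degree = n.degree := Finsupp.degree_mapDomain _ _
    rw [hdeg, ← hH d e i' j' n.degree σ τ,
      coeff_rename_mapDomain _ (σ.injective.sumMap τ.injective)]
  choose a ha using hwd
  refine ⟨(basisMonomials ((ι ⊕ κ) × ℕ) ℂ).constr ℂ a, fun d e i j n => ?_⟩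
  have h1 : arcMonomial i j n =
      monomial (∑ k, Finsupp.single (Sum.map i j k, n k) 1) (1 : ℂ) := prod_X_eq_monomial _
  rw [← ha _ d e i j n h1, h1]
  exact (basisMonomials ((ι ⊕ κ) × ℕ) ℂ).constr_basis ℂ a _

end Functionals

end

section

open MvPolynomial Finset

/-! ### Averaging over permutations -/

section Symmetrization

variable {ι κ : Type*}

/-- The average of a family of polynomials over all permutations of the variables. -/
def symmetrize
    (H : ∀ d e : ℕ, (Fin d → ι) → (Fin e → κ) → ℕ → MvPolynomial (Fin d ⊕ Fin e) ℂ)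
    (d e : ℕ) (i : Fin d → ι) (j : Fin e → κ) (N : ℕ) : MvPolynomial (Fin d ⊕ Fin e) ℂ :=
  (Fintype.card (Equiv.Perm (Fin d) × Equiv.Perm (Fin e)) : ℂ)⁻¹ •
    ∑ g : Equiv.Perm (Fin d) × Equiv.Perm (Fin e),
      rename (Sum.map g.1 g.2) (H d e (i ∘ g.1) (j ∘ g.2) N)

variable (H : ∀ d e : ℕ, (Fin d → ι) → (Fin e → κ) → ℕ → MvPolynomial (Fin d ⊕ Fin e) ℂ)

lemma rename_symmetrize (d e : ℕ) (i : Fin d → ι) (j : Fin e → κ) (N : ℕ)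
    (σ : Equiv.Perm (Fin d)) (τ : Equiv.Perm (Fin e)) :
    rename (Sum.map σ τ) (symmetrize H d e (i ∘ σ) (j ∘ τ) N) = symmetrize H d e i j N := by
  rw [symmetrize, symmetrize, map_smul, map_sum]
  congr 1
  refine Fintype.sum_equiv (Equiv.mulLeft (σ, τ)) _ _ fun g => ?_
  rw [rename_rename, Sum.map_comp_map]
  rfl

/-- A linear map constant on the permuted copies takes the same value on their average; averaging
thus preserves prescribed restrictions. -/
lemma symmetrize_eq_of_forall (d e : ℕ) (i : Fin d → ι) (j : Fin e → κ) (N : ℕ) {B : Type*}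
    [AddCommGroup B] [Module ℂ B] (T : MvPolynomial (Fin d ⊕ Fin e) ℂ →ₗ[ℂ] B) (b : B)
    (h : ∀ (σ : Equiv.Perm (Fin d)) (τ : Equiv.Perm (Fin e)),
      T (rename (Sum.map σ τ) (H d e (i ∘ σ) (j ∘ τ) N)) = b) :
    T (symmetrize H d e i j N) = b := by
  rw [symmetrize, map_smul, map_sum, sum_congr rfl fun g _ => h g.1 g.2, sum_const, card_univ,
    ← Nat.cast_smul_eq_nsmul ℂ, smul_smul, inv_mul_cancel₀ (Nat.cast_ne_zero.2 Fintype.card_ne_zero),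
    one_smul]

lemma symmetrize_sum (s : Finset ℕ)
    (H : ℕ → ∀ d e : ℕ, (Fin d → ι) → (Fin e → κ) → ℕ → MvPolynomial (Fin d ⊕ Fin e) ℂ)
    (d e : ℕ) (i : Fin d → ι) (j : Fin e → κ) (N : ℕ) :
    symmetrize (fun d e i j N => ∑ m ∈ s, H m d e i j N) d e i j N =
      ∑ m ∈ s, symmetrize (H m) d e i j N := by
  simp only [symmetrize, map_sum]
  rw [sum_comm, smul_sum]

end Symmetrization

/-! ### Injectivity and surjectivity by duality -/

section Core

variable {ι κ : Type*} {S : Type*} [CommRing S] [Algebra ℂ S]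

/-- The universal power series `∑ₙ c⁽ⁿ⁾ tⁿ` of a coordinate `c`. -/
def coordSeries (c : ι ⊕ κ) : PowerSeries (MvPolynomial ((ι ⊕ κ) × ℕ) ℂ) :=
  PowerSeries.mk fun n => X (c, n)

lemma coeff_genPoly_coordSeries (φ : MvPolynomial ((ι ⊕ κ) × ℕ) ℂ →ₗ[ℂ] ℂ) (N : ℕ) {d e : ℕ}
    (i : Fin d → ι) (j : Fin e → κ) (n : Fin d ⊕ Fin e →₀ ℕ) :
    coeff n (genPoly φ N fun k => coordSeries (Sum.map i j k)) =
      if n.degree = N then φ (arcMonomial i j n) else 0 := by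
  simp only [coeff_genPoly, coordSeries, PowerSeries.coeff_mk, arcMonomial]

lemma genPoly_comp {S' K : Type*} [CommRing S'] [Algebra ℂ S'] [Fintype K] (p : S →ₐ[ℂ] S')
    (φ : S' →ₗ[ℂ] ℂ) (N : ℕ) (f : K → PowerSeries S) :
    genPoly (φ ∘ₗ p.toLinearMap) N f = genPoly φ N fun k => PowerSeries.map p.toRingHom (f k) := by
  ext n
  simp only [coeff_genPoly, PowerSeries.coeff_map, LinearMap.comp_apply, AlgHom.toLinearMap_apply,
    map_prod]
  rfl

lemma rename_genPoly_coordSeries (φ : MvPolynomial ((ι ⊕ κ) × ℕ) ℂ →ₗ[ℂ] ℂ) (N : ℕ) {d e : ℕ}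
    (i : Fin d → ι) (j : Fin e → κ) (σ : Fin e ≃ Fin d) :
    rename (Sum.elim id σ) (genPoly φ N fun k => coordSeries (Sum.map i j k)) =
      genPoly φ N fun k => coordSeries (Sum.inl (i k)) * coordSeries (Sum.inr (j (σ.symm k))) := by
  rw [rename_genPoly]
  congr 1
  funext k
  have : (univ.filter fun l => Sum.elim id σ l = k) = {Sum.inl k, Sum.inr (σ.symm k)} := by
    ext l
    rcases l with l | l <;> simp [Equiv.eq_symm_apply]
  rw [this, prod_pair (by simp)]
  rfl

lemma rename_map_genPoly_coordSeries (φ : MvPolynomial ((ι ⊕ κ) × ℕ) ℂ →ₗ[ℂ] ℂ) (N : ℕ) {d e : ℕ}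
    (i : Fin d → ι) (j : Fin e → κ) (σ : Equiv.Perm (Fin d)) (τ : Equiv.Perm (Fin e)) :
    rename (Sum.map σ τ) (genPoly φ N fun k => coordSeries (Sum.map (i ∘ σ) (j ∘ τ) k)) =
      genPoly φ N fun k => coordSeries (Sum.map i j k) := by
  refine (rename_equiv_genPoly φ (Equiv.sumCongr σ τ) N _).trans (congrArg _ (funext fun k => ?_))
  rcases k with k | k <;> simp

lemma exists_rename_equiv_eq_genPoly {z : ι → κ → PowerSeries S}
    (hz : ∀ i j k l, z i j * z k l = z i l * z k j) (φ : S →ₗ[ℂ] ℂ) (d e : ℕ) (i : Fin d → ι)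
    (j : Fin e → κ) (N : ℕ) :
    ∃ H : MvPolynomial (Fin d ⊕ Fin e) ℂ, ∀ σ : Fin e ≃ Fin d,
      rename (Sum.elim id σ) H = genPoly φ N fun k => z (i k) (j (σ.symm k)) := by
  by_cases h : d = e
  · subst h
    exact exists_rename_eq_genPoly hz φ i j N
  · exact ⟨0, fun σ => absurd (by simpa using Fintype.card_congr σ.symm) h⟩

lemma span_prod_coeff_eq_top {z : ι → κ → PowerSeries S}
    (hgen : Algebra.adjoin ℂ {s | ∃ i j n, s = PowerSeries.coeff n (z i j)} = ⊤) :
    Submodule.span ℂ {s : S | ∃ (d : ℕ) (i : Fin d → ι) (j : Fin d → κ) (n : Fin d → ℕ),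
      s = ∏ k, PowerSeries.coeff (n k) (z (i k) (j k))} = ⊤ := by
  have h := congrArg Subalgebra.toSubmodule hgen
  rw [Algebra.adjoin_eq_span, Algebra.top_toSubmodule] at h
  rw [eq_top_iff, ← h]
  refine Submodule.span_mono fun s hs => ?_
  induction hs using Submonoid.closure_induction_left with
  | one => exact ⟨0, Fin.elim0, Fin.elim0, Fin.elim0, by simp⟩
  | mul_left x hx y hy ih =>
    obtain ⟨i, j, n, rfl⟩ := hx
    obtain ⟨d, i', j', n', rfl⟩ := ih
    exact ⟨d + 1, Fin.cons i i', Fin.cons j j', Fin.cons n n', by simp [Fin.prod_univ_succ]⟩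

variable {z : ι → κ → PowerSeries S} {p : S →ₐ[ℂ] MvPolynomial ((ι ⊕ κ) × ℕ) ℂ}

/-- Every linear functional on `S` extends along `p`. -/
lemma exists_functional_comp_eq (hz : ∀ i j k l, z i j * z k l = z i l * z k j)
    (hgen : Algebra.adjoin ℂ {s | ∃ i j n, s = PowerSeries.coeff n (z i j)} = ⊤)
    (hp : ∀ i j, PowerSeries.map p.toRingHom (z i j) =
      coordSeries (Sum.inl i) * coordSeries (Sum.inr j)) (φ : S →ₗ[ℂ] ℂ) :
    ∃ ψ : MvPolynomial ((ι ⊕ κ) × ℕ) ℂ →ₗ[ℂ] ℂ, ψ ∘ₗ p.toLinearMap = φ := by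
  choose H hH using exists_rename_equiv_eq_genPoly hz φ
  obtain ⟨ψ, hψ⟩ := exists_functional_arcMonomial (symmetrize H) (rename_symmetrize H)
  refine ⟨ψ, LinearMap.ext_on (span_prod_coeff_eq_top hgen) ?_⟩
  rintro _ ⟨d, i, j, n, rfl⟩
  set N := (Finsupp.equivFunOnFinite.symm n).degree with hN
  -- The functional `ψ` reads the member of index `N` only in degree `N`. Nothing is lost, since
  -- `genPoly φ N` is homogeneous of that degree.
  have h1 : (genPoly ψ N fun k => coordSeries (Sum.map i j k)) =
      homogeneousComponent N (symmetrize H d d i j N) := by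
    ext m
    rw [coeff_genPoly_coordSeries, coeff_homogeneousComponent]
    split_ifs with h
    · rw [hψ, h]
    · rfl
  -- On the diagonal `v = u`, each permuted copy of an interpolating polynomial restricts to the
  -- same generating polynomial, up to a renaming of `u` that cancels.
  have h2 : rename (Sum.elim id (Equiv.refl (Fin d))) (symmetrize H d d i j N) =
      genPoly φ N fun k => z (i k) (j k) := by
    refine symmetrize_eq_of_forall H d d i j N
      (rename (Sum.elim id (Equiv.refl (Fin d))) : _ →ₐ[ℂ] MvPolynomial (Fin d) ℂ).toLinearMap _
      fun σ τ => ?_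
    rw [AlgHom.toLinearMap_apply, rename_rename]
    have : Sum.elim id (Equiv.refl (Fin d)) ∘ Sum.map σ τ =
        σ ∘ Sum.elim id (τ.trans σ.symm) := by
      funext k
      rcases k with k | k <;> simp
    rw [this, ← rename_rename, hH, rename_equiv_genPoly]
    simp
  have h3 : genPoly (ψ ∘ₗ p.toLinearMap) N (fun k => z (i k) (j k)) =
      genPoly φ N fun k => z (i k) (j k) := by
    rw [genPoly_comp]
    simp only [hp]
    have h4 := rename_genPoly_coordSeries ψ N i j (Equiv.refl (Fin d))
    rw [h1, rename_homogeneousComponent, h2] at h4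
    rw [Equiv.refl_symm] at h4
    simp only [Equiv.refl_apply] at h4
    rw [← h4]
    ext m
    rw [coeff_homogeneousComponent, coeff_genPoly]
    split_ifs <;> rfl
  have h5 := congrArg (coeff (Finsupp.equivFunOnFinite.symm n)) h3
  rw [coeff_genPoly, coeff_genPoly, if_pos hN.symm, if_pos hN.symm] at h5
  exact h5

/-- Each functional on `S` factors through `p`, so an element of the kernel is killed by all
functionals. -/
theorem injective_of_generic_rank_one (hz : ∀ i j k l, z i j * z k l = z i l * z k j)
    (hgen : Algebra.adjoin ℂ {s | ∃ i j n, s = PowerSeries.coeff n (z i j)} = ⊤)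
    (hp : ∀ i j, PowerSeries.map p.toRingHom (z i j) =
      coordSeries (Sum.inl i) * coordSeries (Sum.inr j)) : Function.Injective p := by
  rw [injective_iff_map_eq_zero]
  intro s hs
  rw [← Module.forall_dual_apply_eq_zero_iff ℂ]
  intro φ
  obtain ⟨ψ, rfl⟩ := exists_functional_comp_eq hz hgen hp φ
  rw [LinearMap.comp_apply, AlgHom.toLinearMap_apply, hs, map_zero]

/-- The vector field on the arc space of a vector space given by the element `t ^ m` of the
Lie algebra of the arc space of the torus. -/
def arcDerivation (m : ℕ) :
    Derivation ℂ (MvPolynomial ((ι ⊕ κ) × ℕ) ℂ) (MvPolynomial ((ι ⊕ κ) × ℕ) ℂ) :=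
  mkDerivation ℂ fun c => Sum.elim (fun _ => (1 : ℂ)) (fun _ => -1) c.1 •
    if m ≤ c.2 then X (c.1, c.2 - m) else 0

lemma derivation_prod {R A K : Type*} [CommRing R] [CommRing A] [Algebra R A] [DecidableEq K]
    (D : Derivation R A A) (s : Finset K) (f : K → A) :
    D (∏ k ∈ s, f k) = ∑ k ∈ s, D (f k) * ∏ l ∈ s.erase k, f l := by
  induction s using Finset.induction_on with
  | empty => simp
  | insert a s ha ih =>
    rw [prod_insert ha, D.leibniz, sum_insert ha, erase_insert ha, ih, smul_eq_mul, smul_eq_mul,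
      mul_sum, add_comm, mul_comm]
    congr 1
    refine sum_congr rfl fun k hk => ?_
    have hka : k ≠ a := fun h => ha (h ▸ hk)
    rw [erase_insert_of_ne hka.symm, prod_insert (fun h => ha (mem_of_mem_erase h))]
    ring

/-- Lowering one exponent by `m`, with sign, is the transpose of multiplying generating polynomials
by `powDiff d e m`. -/
lemma arcDerivation_arcMonomial (m : ℕ) {d e : ℕ} (i : Fin d → ι) (j : Fin e → κ)
    (n : Fin d ⊕ Fin e →₀ ℕ) :
    arcDerivation m (arcMonomial i j n) = ∑ k, Sum.elim (fun _ => (1 : ℂ)) (fun _ => -1) k •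
      if m ≤ n k then arcMonomial i j (n - Finsupp.single k m) else 0 := by
  classical
  rw [arcMonomial, derivation_prod]
  refine sum_congr rfl fun k _ => ?_
  rw [arcDerivation, mkDerivation_X, smul_mul_assoc]
  congr 1
  · rcases k with k | k <;> rfl
  · dsimp only
    split_ifs with h
    · rw [arcMonomial, ← mul_prod_erase univ _ (mem_univ k)]
      congr 1
      · simp
      · refine prod_congr rfl fun l hl => ?_
        simp [(ne_of_mem_erase hl).symm]
    · rw [zero_mul]

/-- The difference of the power sums of the two sets of variables. -/
def powDiff (d e m : ℕ) : MvPolynomial (Fin d ⊕ Fin e) ℂ :=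
  ∑ k, X (Sum.inl k) ^ m - ∑ l, X (Sum.inr l) ^ m

/-- For `d = e` the generating polynomial vanishes at all permutations because `φ` kills the image
of `p`. For `d ≠ e` the power sum difference of index `0` is the invertible constant `d - e`. The
family `K` does not depend on `M`. -/
lemma exists_genPoly_eq_sum (hp : ∀ i j, PowerSeries.map p.toRingHom (z i j) =
      coordSeries (Sum.inl i) * coordSeries (Sum.inr j))
    (φ : MvPolynomial ((ι ⊕ κ) × ℕ) ℂ →ₗ[ℂ] ℂ) (hφ : φ ∘ₗ p.toLinearMap = 0) (d e : ℕ)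
    (i : Fin d → ι) (j : Fin e → κ) (N : ℕ) :
    ∃ K : ℕ → MvPolynomial (Fin d ⊕ Fin e) ℂ, ∀ M, d < M →
      (genPoly φ N fun k => coordSeries (Sum.map i j k)) =
        ∑ m ∈ range M, K m * powDiff d e m := by
  by_cases h : d = e
  · subst h
    obtain ⟨K, hK, hQ⟩ := exists_eq_sum_of_rename_eq_zero
      (genPoly φ N fun k => coordSeries (Sum.map i j k)) (fun σ => by
        rw [rename_genPoly_coordSeries]
        simp only [← hp]
        rw [← genPoly_comp, hφ]
        ext n
        simp [coeff_genPoly])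
    refine ⟨K, fun M hM => hQ.trans (sum_subset (range_subset_range.2 hM) fun m _ hm => ?_)⟩
    rw [hK m (by simpa using hm), zero_mul]
  · refine ⟨fun m => if m = 0 then C ((d - e : ℂ)⁻¹) * genPoly φ N fun k =>
      coordSeries (Sum.map i j k) else 0, fun M hM => ?_⟩
    rw [sum_eq_single_of_mem 0 (mem_range.2 (by omega)) fun m _ hm => by
      simp only [if_neg hm, zero_mul]]
    have hde : (d - e : ℂ) ≠ 0 := sub_ne_zero.2 (Nat.cast_injective.ne h)
    have h1 : powDiff d e 0 = C (d - e : ℂ) := by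
      simp [powDiff]
    simp only [h1, if_true]
    rw [mul_right_comm, ← C_mul, inv_mul_cancel₀ hde, C_1, one_mul]

/-- The factor `powDiff` is invariant under separate permutations of `u` and `v`. -/
lemma symmetrize_mul {d e : ℕ} (i : Fin d → ι) (j : Fin e → κ) (N : ℕ)
    (H : ∀ d e : ℕ, (Fin d → ι) → (Fin e → κ) → ℕ → MvPolynomial (Fin d ⊕ Fin e) ℂ) (m : ℕ) :
    symmetrize H d e i j N * powDiff d e m =
      symmetrize (fun d e i j N => H d e i j N *
        powDiff d e m) d e i j N := by
  rw [symmetrize, symmetrize, smul_mul_assoc, sum_mul]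
  congr 1
  refine sum_congr rfl fun g _ => ?_
  rw [map_mul]
  congr 1
  simp only [powDiff, map_sub, map_sum, map_pow, rename_X, Sum.map_inl, Sum.map_inr]
  rw [Equiv.sum_comp g.1 fun k => (X (Sum.inl k) : MvPolynomial (Fin d ⊕ Fin e) ℂ) ^ m,
    Equiv.sum_comp g.2 fun k => (X (Sum.inr k) : MvPolynomial (Fin d ⊕ Fin e) ℂ) ^ m]

/-- A functional `φ` that vanishes on the image is, on each polynomial, a finite sum of `ψ m ∘
arcDerivation m`, hence cannot detect `f`. -/
theorem mem_range_of_arcDerivation_eq_zero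
    (hp : ∀ i j, PowerSeries.map p.toRingHom (z i j) =
      coordSeries (Sum.inl i) * coordSeries (Sum.inr j))
    {f : MvPolynomial ((ι ⊕ κ) × ℕ) ℂ} (hf : ∀ m, arcDerivation m f = 0) : f ∈ p.range := by
  classical
  by_contra hfp
  obtain ⟨φ, hφf, hφ⟩ := Submodule.exists_le_ker_of_notMem
    (p := LinearMap.range p.toLinearMap) (v := f) (fun h => hfp h)
  have hφp : φ ∘ₗ p.toLinearMap = 0 := LinearMap.ext fun s => hφ ⟨s, rfl⟩
  choose K hK using exists_genPoly_eq_sum hp φ hφp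
  -- The shift `N + m` compensates for `powDiff d e m`, which is homogeneous of degree `m`: the
  -- degree `N` part of `K` contributes to total degree `N + m`.
  choose ψ hψ using fun m : ℕ => exists_functional_arcMonomial
    (symmetrize fun d e i j N => K d e i j (N + m) m) (rename_symmetrize _)
  have key : ∀ d e (i : Fin d → ι) (j : Fin e → κ) n M, d < M →
      φ (arcMonomial i j n) = ∑ m ∈ range M, ψ m (arcDerivation m (arcMonomial i j n)) := by
    intro d e i j n M hM
    have h1 : (genPoly φ n.degree fun k => coordSeries (Sum.map i j k)) =
        ∑ m ∈ range M, symmetrize (fun d e i j N => K d e i j N m) d e i j n.degree *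
          powDiff d e m := by
      simp only [symmetrize_mul]
      have h2 := symmetrize_eq_of_forall (fun d e i j N => ∑ m ∈ range M, K d e i j N m *
        powDiff d e m) d e i j n.degree LinearMap.id
        (genPoly φ n.degree fun k => coordSeries (Sum.map i j k)) fun σ τ => by
          rw [LinearMap.id_apply, ← hK _ _ _ _ _ M hM, rename_map_genPoly_coordSeries]
      rw [LinearMap.id_apply] at h2
      rw [← h2]
      exact symmetrize_sum (range M) (fun m d e i j N => K d e i j N m * powDiff d e m) d e i j _
    have h3 := congrArg (coeff n) h1
    rw [coeff_genPoly_coordSeries, if_pos rfl, coeff_sum] at h3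
    rw [h3]
    refine sum_congr rfl fun m _ => ?_
    have h4 : powDiff d e m =
        ∑ k, monomial (Finsupp.single k m) (Sum.elim (fun _ => (1 : ℂ)) (fun _ => -1) k) := by
      simp [powDiff, Fintype.sum_sum_type, X_pow_eq_monomial, sub_eq_add_neg]
    rw [h4, mul_sum, coeff_sum, arcDerivation_arcMonomial, map_sum]
    refine sum_congr rfl fun k _ => ?_
    rw [coeff_mul_monomial', map_smul, smul_eq_mul]
    simp only [Finsupp.single_le_iff]
    split_ifs with h
    · rw [hψ, mul_comm]
      congr 2
      have h5 : (n - Finsupp.single k m).degree + m = n.degree := by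
        have h6 : n - Finsupp.single k m + Finsupp.single k m = n :=
          tsub_add_cancel_of_le (Finsupp.single_le_iff.2 h)
        conv_rhs => rw [← h6, map_add, Finsupp.degree_single]
      simp only [symmetrize, h5]
    · rw [map_zero, mul_zero]
  -- The number of terms needed depends on the number of `x` factors of the monomials, which is
  -- bounded for a given `g`.
  have key2 : ∀ g : MvPolynomial ((ι ⊕ κ) × ℕ) ℂ, ∃ M0, ∀ M, M0 ≤ M →
      φ g = ∑ m ∈ range M, ψ m (arcDerivation m g) := by
    intro g
    have hg : g ∈ (⊤ : Submodule ℂ (MvPolynomial ((ι ⊕ κ) × ℕ) ℂ)) := Submodule.mem_top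
    rw [← span_arcMonomial_eq_top] at hg
    induction hg using Submodule.span_induction with
    | mem g hg =>
      obtain ⟨d, e, i, j, n, rfl⟩ := hg
      exact ⟨d + 1, fun M hM => key d e i j n M hM⟩
    | zero => exact ⟨0, fun M _ => by simp⟩
    | add g h _ _ hg hh =>
      obtain ⟨M1, h1⟩ := hg
      obtain ⟨M2, h2⟩ := hh
      refine ⟨max M1 M2, fun M hM => ?_⟩
      rw [map_add, h1 M (le_of_max_le_left hM), h2 M (le_of_max_le_right hM), ← sum_add_distrib]
      simp only [map_add]
    | smul a g _ hg =>
      obtain ⟨M1, h1⟩ := hg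
      refine ⟨M1, fun M hM => ?_⟩
      rw [map_smul, h1 M hM, smul_sum]
      refine sum_congr rfl fun m _ => ?_
      rw [Derivation.map_smul, LinearMap.map_smul]
  obtain ⟨M, hM⟩ := key2 f
  apply hφf
  rw [hM M le_rfl]
  simp [hf]

end Core

end

section

open MvPolynomial

/-! ### Coordinates on `V` -/

section WeightBasis

variable {V : Type u} [AddCommGroup V] [Module ℂ V] {σ : Type}
  (b : Module.Basis σ ℂ V)

/-- The coordinates with respect to a basis, as elements of the coordinate ring. -/
def coordFun (c : σ) : coordRing V :=
  ⟨fun v => b.coord c v, Algebra.subset_adjoin ⟨b.coord c, rfl⟩⟩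

lemma aeval_coordFun_apply (f : MvPolynomial σ ℂ) (v : V) :
    (aeval (coordFun b) f : V → ℂ) v = eval (fun c => b.repr v c) f := by
  have h : ((Pi.evalAlgHom ℂ (fun _ : V => ℂ) v).comp ((coordRing V).val.comp
      (aeval (coordFun b)))) = aeval fun c => b.repr v c := by
    refine algHom_ext fun c => ?_
    simp only [AlgHom.comp_apply, aeval_X]
    rfl
  exact DFunLike.congr_fun h f

variable [Fintype σ]

lemma aeval_coordFun_injective : Function.Injective (aeval (R := ℂ) (coordFun b)) := by
  intro f g h
  refine MvPolynomial.funext fun x => ?_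
  have h1 := congrFun (congrArg Subtype.val h) (b.equivFun.symm x)
  rw [aeval_coordFun_apply, aeval_coordFun_apply] at h1
  have h2 : (fun c => b.repr (b.equivFun.symm x) c) = x := by
    rw [← Module.Basis.equivFun_apply, LinearEquiv.apply_symm_apply]
  rwa [h2] at h1

lemma aeval_coordFun_surjective : Function.Surjective (aeval (R := ℂ) (coordFun b)) := by
  intro r
  suffices h : coordRing V ≤ (aeval (R := ℂ) (coordFun b)).range.map (coordRing V).val by
    obtain ⟨_, ⟨f, rfl⟩, hf⟩ := h r.2
    exact ⟨f, Subtype.ext hf⟩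
  refine Algebra.adjoin_le ?_
  rintro _ ⟨ξ, rfl⟩
  refine ⟨_, ⟨∑ c, C (ξ (b c)) * X c, rfl⟩, ?_⟩
  funext v
  change (aeval (coordFun b) (∑ c, C (ξ (b c)) * X c) : V → ℂ) v = _
  rw [aeval_coordFun_apply, map_sum]
  change _ = ξ v
  conv_rhs => rw [← b.sum_repr v, map_sum]
  refine Finset.sum_congr rfl fun c _ => ?_
  rw [map_mul, eval_C, eval_X, map_smul, smul_eq_mul, mul_comm]

/-- The coordinate ring of a vector space is a polynomial ring. -/
def coordEquiv : MvPolynomial σ ℂ ≃ₐ[ℂ] coordRing V :=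
  AlgEquiv.ofBijective (aeval (coordFun b)) ⟨aeval_coordFun_injective b, aeval_coordFun_surjective b⟩

lemma coordEquiv_X (c : σ) : coordEquiv b (X c) = coordFun b c := aeval_X _ _

lemma coordRing_algHom_ext {B : Type*} [CommRing B] [Algebra ℂ B] {f g : coordRing V →ₐ[ℂ] B}
    (h : ∀ c, f (coordFun b c) = g (coordFun b c)) : f = g := by
  have h1 : f.comp (coordEquiv b).toAlgHom = g.comp (coordEquiv b).toAlgHom :=
    algHom_ext fun c => by
      change f (coordEquiv b (X c)) = g (coordEquiv b (X c))
      rw [coordEquiv_X, h c]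
  ext r
  obtain ⟨p, rfl⟩ := (coordEquiv b).surjective r
  exact DFunLike.congr_fun h1 p

lemma arcAlgebra_algHom_ext {B : Type*} [CommRing B] [Algebra ℂ B]
    {f g : ArcAlgebra ℂ (coordRing V) →ₐ[ℂ] B}
    (h : ∀ c n, f (PowerSeries.coeff n (ArcAlgebra.universalArc ℂ (coordRing V) (coordFun b c))) =
      g (PowerSeries.coeff n (ArcAlgebra.universalArc ℂ (coordRing V) (coordFun b c)))) : f = g := by
  refine ArcAlgebra.equiv.injective (coordRing_algHom_ext b fun c => ?_)
  ext n
  change PowerSeries.coeff n (PowerSeries.map f.toRingHom _) =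
    PowerSeries.coeff n (PowerSeries.map g.toRingHom _)
  rw [PowerSeries.coeff_map, PowerSeries.coeff_map]
  exact h c n

lemma coeff_aeval_C_mul_X {R : Type*} [CommRing R] (w : σ → R) (f : MvPolynomial σ R)
    (m : σ →₀ ℕ) :
    coeff m (aeval (fun c => C (w c) * X c) f) = (∏ c, w c ^ m c) * coeff m f := by
  classical
  induction f using MvPolynomial.induction_on' with
  | monomial n a =>
    rw [aeval_monomial, Finsupp.prod_fintype _ _ fun _ => pow_zero _]
    simp only [mul_pow, Finset.prod_mul_distrib, ← map_pow, ← map_prod]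
    rw [algebraMap_eq, ← Finsupp.prod_fintype n (fun c k => (X c : MvPolynomial σ R) ^ k)
      fun _ => pow_zero _, ← mul_assoc, ← C_mul, ← monomial_eq, coeff_monomial, coeff_monomial]
    split_ifs with h
    · rw [h, mul_comm]
    · rw [mul_zero]
  | add p q hp hq => rw [map_add, coeff_add, hp, hq, coeff_add, mul_add]

end WeightBasis

/-! ### Invariants of the torus -/

section Invariants

variable {V : Type u} [AddCommGroup V] [Module ℂ V] {ι κ : Type}
  (b : Module.Basis (ι ⊕ κ) ℂ V) (ρ : Representation ℂ ℂˣ V)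

/-- The basis `b` consists of vectors of weight `1` (the left part) and `-1` (the right part). -/
structure IsWeightBasis : Prop where
  inl (i : ι) (t : ℂˣ) : ρ t (b (Sum.inl i)) = (t : ℂ) • b (Sum.inl i)
  inr (j : κ) (t : ℂˣ) : ρ t (b (Sum.inr j)) = (t : ℂ)⁻¹ • b (Sum.inr j)

variable {b ρ} (hb : IsWeightBasis b ρ)
include hb

lemma IsWeightBasis.repr_apply (t : ℂˣ) (v : V) (c : ι ⊕ κ) :
    b.repr (ρ t v) c = Sum.elim (fun _ => (t : ℂ)) (fun _ => (t : ℂ)⁻¹) c * b.repr v c := by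
  have h : b.coord c ∘ₗ ρ t =
      Sum.elim (fun _ => (t : ℂ)) (fun _ => (t : ℂ)⁻¹) c • b.coord c := by
    refine b.ext fun c' => ?_
    rw [LinearMap.comp_apply, LinearMap.smul_apply]
    rcases c' with i | j
    · rw [hb.inl, map_smul, Module.Basis.coord_apply, Module.Basis.repr_self]
      rcases c with c | c <;> simp
    · rw [hb.inr, map_smul, Module.Basis.coord_apply, Module.Basis.repr_self]
      rcases c with c | c <;> simp
  exact DFunLike.congr_fun h v

/-- The invariant `x_i y_j`. -/
def IsWeightBasis.invariant (i : ι) (j : κ) : invariants ρ :=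
  ⟨coordFun b (Sum.inl i) * coordFun b (Sum.inr j), fun t v => by
    change b.repr (ρ t v) (Sum.inl i) * b.repr (ρ t v) (Sum.inr j) =
      b.repr v (Sum.inl i) * b.repr v (Sum.inr j)
    rw [hb.repr_apply, hb.repr_apply, Sum.elim_inl, Sum.elim_inr]
    field_simp⟩

variable [Fintype ι] [Fintype κ]

/-- Acting by the single element `2` is enough, because its powers are distinct. -/
lemma IsWeightBasis.sum_eq_sum_of_mem_invariants {f : MvPolynomial (ι ⊕ κ) ℂ}
    (hf : aeval (coordFun b) f ∈ invariants ρ) {m : (ι ⊕ κ) →₀ ℕ} (hm : coeff m f ≠ 0) :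
    ∑ i, m (Sum.inl i) = ∑ j, m (Sum.inr j) := by
  have h2 : (2 : ℂ) ≠ 0 := two_ne_zero
  set w : ι ⊕ κ → ℂ := Sum.elim (fun _ => (2 : ℂ)) (fun _ => (2 : ℂ)⁻¹) with hw
  have h1 : aeval (fun c => C (w c) * X c) f = f := by
    refine MvPolynomial.funext fun x => ?_
    have h3 := hf (Units.mk0 2 h2) (b.equivFun.symm x)
    rw [aeval_coordFun_apply, aeval_coordFun_apply] at h3
    have h4 : ∀ c, b.repr (b.equivFun.symm x) c = x c := fun c => by
      rw [← Module.Basis.equivFun_apply, LinearEquiv.apply_symm_apply]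
    simp only [hb.repr_apply, h4, Units.val_mk0] at h3
    rw [← h3, ← coe_aeval_eq_eval, ← coe_aeval_eq_eval, RingHom.coe_coe, RingHom.coe_coe,
      comp_aeval_apply]
    simp [hw]
  have h3 := coeff_aeval_C_mul_X w f m
  rw [h1] at h3
  have h4 : ∏ c, w c ^ m c = 1 := by
    have h5 : (∏ c, w c ^ m c - 1) * coeff m f = 0 := by rw [sub_mul, ← h3, one_mul, sub_self]
    exact sub_eq_zero.1 ((mul_eq_zero.1 h5).resolve_right hm)
  rw [Fintype.prod_sum_type] at h4
  simp only [hw, Sum.elim_inl, Sum.elim_inr, inv_pow, Finset.prod_inv_distrib,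
    Finset.prod_pow_eq_pow_sum] at h4
  rw [mul_inv_eq_one₀ (pow_ne_zero _ h2)] at h4
  exact_mod_cast Nat.pow_right_injective le_rfl (by exact_mod_cast h4)

lemma IsWeightBasis.monomial_mem_adjoin (d : ℕ) : ∀ m : (ι ⊕ κ) →₀ ℕ,
    ∑ i, m (Sum.inl i) = d → ∑ j, m (Sum.inr j) = d →
    aeval (coordFun b) (monomial m (1 : ℂ)) ∈ (Algebra.adjoin ℂ
      {r | ∃ i j, r = hb.invariant i j}).map (invariants ρ).val := by
  classical
  induction d with
  | zero =>
    intro m h1 h2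
    have : m = 0 := by
      ext c
      rcases c with c | c
      · exact Finset.sum_eq_zero_iff.1 h1 c (Finset.mem_univ c)
      · exact Finset.sum_eq_zero_iff.1 h2 c (Finset.mem_univ c)
    rw [this, monomial_zero', C_1, map_one]
    exact one_mem _
  | succ d ih =>
    intro m h1 h2
    obtain ⟨i, -, hi⟩ := Finset.exists_ne_zero_of_sum_ne_zero (h1.trans_ne d.succ_ne_zero)
    obtain ⟨j, -, hj⟩ := Finset.exists_ne_zero_of_sum_ne_zero (h2.trans_ne d.succ_ne_zero)
    set s : (ι ⊕ κ) →₀ ℕ := Finsupp.single (Sum.inl i) 1 + Finsupp.single (Sum.inr j) 1 with hs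
    have hle : s ≤ m := by
      intro c
      rcases c with c | c
      · simp only [hs, Finsupp.add_apply, Finsupp.single_apply, Sum.inl.injEq, reduceCtorEq,
          if_false, add_zero]
        split_ifs with h
        · subst h; omega
        · omega
      · simp only [hs, Finsupp.add_apply, Finsupp.single_apply, Sum.inr.injEq, reduceCtorEq,
          if_false, zero_add]
        split_ifs with h
        · subst h; omega
        · omega
    obtain ⟨n, rfl⟩ : ∃ n, m = n + s := ⟨m - s, (tsub_add_cancel_of_le hle).symm⟩
    have h3 : ∑ k, s (Sum.inl k) = 1 := by simp [hs, Finsupp.single_apply]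
    have h4 : ∑ k, s (Sum.inr k) = 1 := by simp [hs, Finsupp.single_apply]
    simp only [Finsupp.add_apply, Finset.sum_add_distrib, h3, h4] at h1 h2
    have h5 : monomial (n + s) (1 : ℂ) = monomial n 1 * (X (Sum.inl i) * X (Sum.inr j)) := by
      rw [X, X, monomial_mul, monomial_mul, mul_one, mul_one]
    rw [h5, map_mul]
    refine mul_mem (ih n (by omega) (by omega)) ⟨hb.invariant i j,
      Algebra.subset_adjoin ⟨i, j, rfl⟩, ?_⟩
    rw [map_mul, aeval_X, aeval_X]
    rfl

/-- The first fundamental theorem for a torus of dimension one with weights `1` and `-1`. -/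
theorem IsWeightBasis.adjoin_invariant :
    Algebra.adjoin ℂ {r | ∃ i j, r = hb.invariant i j} = ⊤ := by
  rw [eq_top_iff]
  rintro r -
  obtain ⟨f, hf⟩ := aeval_coordFun_surjective b (r : coordRing V)
  have h1 : aeval (coordFun b) f ∈ (Algebra.adjoin ℂ
      {r | ∃ i j, r = hb.invariant i j}).map (invariants ρ).val := by
    rw [f.as_sum, map_sum]
    refine sum_mem fun m hm => ?_
    have h2 := hb.sum_eq_sum_of_mem_invariants (hf ▸ r.2) (mem_support_iff.1 hm)
    rw [← mul_one (coeff m f), ← smul_eq_mul, ← smul_monomial, map_smul]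
    exact Subalgebra.smul_mem _ (hb.monomial_mem_adjoin _ m rfl h2.symm) _
  obtain ⟨r', hr', h2⟩ := h1
  rw [hf] at h2
  rwa [← Subtype.ext (a1 := r') (a2 := r) h2]

/-- The coordinate ring of the arc space of the quotient is generated by the coefficients of the
universal power series of the invariants `x_i y_j`. -/
lemma IsWeightBasis.adjoin_coeff_universalArc_invariant :
    Algebra.adjoin ℂ {s | ∃ i j n, s = PowerSeries.coeff n
      (ArcAlgebra.universalArc ℂ (invariants ρ) (hb.invariant i j))} = ⊤ := by
  set B := Algebra.adjoin ℂ {s | ∃ i j n, s = PowerSeries.coeff n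
      (ArcAlgebra.universalArc ℂ (invariants ρ) (hb.invariant i j))} with hB
  have h1 : ∀ r ∈ (⊤ : Subalgebra ℂ (invariants ρ)), ∀ n, PowerSeries.coeff n
      (ArcAlgebra.universalArc ℂ (invariants ρ) r) ∈ B := by
    rw [← hb.adjoin_invariant]
    intro r hr
    induction hr using Algebra.adjoin_induction with
    | mem r hr =>
      obtain ⟨i, j, rfl⟩ := hr
      exact fun n => Algebra.subset_adjoin ⟨i, j, n, rfl⟩
    | algebraMap a =>
      intro n
      rw [AlgHom.commutes, PowerSeries.algebraMap_apply, PowerSeries.coeff_C]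
      split_ifs
      · exact B.algebraMap_mem a
      · exact zero_mem _
    | add r s _ _ hr hs =>
      intro n
      rw [map_add, map_add]
      exact add_mem (hr n) (hs n)
    | mul r s _ _ hr hs =>
      intro n
      rw [map_mul, PowerSeries.coeff_mul]
      exact sum_mem fun x _ => mul_mem (hr _) (hs _)
  rw [eq_top_iff]
  rintro s -
  obtain ⟨q, rfl⟩ := ArcAlgebra.mk_surjective s
  induction q using MvPolynomial.induction_on with
  | C a =>
    rw [← algebraMap_eq, AlgHom.commutes]
    exact B.algebraMap_mem a
  | add p q hp hq =>
    rw [map_add]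
    exact add_mem hp hq
  | mul_X p c hp =>
    rw [map_mul, ← ArcAlgebra.coeff_universalArc]
    exact mul_mem hp (h1 _ Algebra.mem_top _)

end Invariants

/-! ### Coordinates on the arc spaces -/

section ArcCoordinates

variable {V : Type u} [AddCommGroup V] [Module ℂ V] {ι κ : Type} [Fintype ι] [Fintype κ]
  (b : Module.Basis (ι ⊕ κ) ℂ V)

/-- The universal arc of a vector space in terms of coordinates. -/
def coordArc : coordRing V →ₐ[ℂ] PowerSeries (MvPolynomial ((ι ⊕ κ) × ℕ) ℂ) :=
  (aeval coordSeries).comp (coordEquiv b).symm.toAlgHom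

lemma coordArc_coordFun (c : ι ⊕ κ) : coordArc b (coordFun b c) = coordSeries c := by
  rw [← coordEquiv_X]
  change aeval coordSeries ((coordEquiv b).symm (coordEquiv b (X c))) = _
  rw [AlgEquiv.symm_apply_apply, aeval_X]

/-- The coordinate ring of the arc space of a vector space is a polynomial ring. -/
def arcCoord : ArcAlgebra ℂ (coordRing V) →ₐ[ℂ] MvPolynomial ((ι ⊕ κ) × ℕ) ℂ :=
  ArcAlgebra.lift (coordArc b)

lemma arcCoord_coeff_universalArc (r : coordRing V) (n : ℕ) :
    arcCoord b (PowerSeries.coeff n (ArcAlgebra.universalArc ℂ (coordRing V) r)) =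
      PowerSeries.coeff n (coordArc b r) := by
  rw [ArcAlgebra.coeff_universalArc, arcCoord, ArcAlgebra.lift_mk_X]

/-- A left inverse sends the variable `(c, n)` to the `n`-th coefficient of the universal arc of the
coordinate `c`. -/
lemma arcCoord_injective : Function.Injective (arcCoord b) := by
  have h : (aeval fun c : (ι ⊕ κ) × ℕ => PowerSeries.coeff c.2
      (ArcAlgebra.universalArc ℂ (coordRing V) (coordFun b c.1))).comp (arcCoord b) =
      AlgHom.id ℂ _ := by
    refine arcAlgebra_algHom_ext b fun c n => ?_
    rw [AlgHom.comp_apply, arcCoord_coeff_universalArc, coordArc_coordFun, coordSeries,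
      PowerSeries.coeff_mk, aeval_X]
    rfl
  exact Function.LeftInverse.injective (g := aeval fun c : (ι ⊕ κ) × ℕ => PowerSeries.coeff c.2
    (ArcAlgebra.universalArc ℂ (coordRing V) (coordFun b c.1))) fun x => DFunLike.congr_fun h x

variable {b} {ρ : Representation ℂ ℂˣ V} (hb : IsWeightBasis b ρ)
include hb

lemma IsWeightBasis.map_universalArc_invariant (i : ι) (j : κ) :
    PowerSeries.map ((arcCoord b).comp (arcPullback ρ)).toRingHom
      (ArcAlgebra.universalArc ℂ (invariants ρ) (hb.invariant i j)) =
      coordSeries (Sum.inl i) * coordSeries (Sum.inr j) := by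
  ext1 n
  rw [PowerSeries.coeff_map]
  change arcCoord b (arcPullback ρ _) = _
  rw [arcPullback, ArcAlgebra.map_coeff_universalArc, arcCoord_coeff_universalArc,
    ← coordArc_coordFun b, ← coordArc_coordFun b, ← map_mul]
  rfl

theorem IsWeightBasis.arcCoord_arcPullback_injective :
    Function.Injective ((arcCoord b).comp (arcPullback ρ)) := by
  refine injective_of_generic_rank_one
    (z := fun i j => ArcAlgebra.universalArc ℂ (invariants ρ) (hb.invariant i j))
    (fun i j k l => ?_) hb.adjoin_coeff_universalArc_invariant hb.map_universalArc_invariant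
  rw [← map_mul, ← map_mul]
  congr 1
  refine Subtype.ext ?_
  change coordFun b _ * coordFun b _ * (coordFun b _ * coordFun b _) =
    coordFun b _ * coordFun b _ * (coordFun b _ * coordFun b _)
  ring

end ArcCoordinates

end

section

open MvPolynomial

/-! ### Tangent direction of the torus at the identity -/

section Tangent

variable {V : Type u} [AddCommGroup V] [Module ℂ V]

/-- The exponential map of the torus `ℂˣ`. -/
def expUnit (z : ℂ) : ℂˣ := Units.mk0 (Complex.exp z) (Complex.exp_ne_zero z)

lemma expUnit_zero : expUnit 0 = 1 := Units.ext Complex.exp_zero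

lemma coordRingProd_differentiableAt {f : ℂˣ × V → ℂ} (hf : f ∈ coordRingProd V) (v : V) :
    DifferentiableAt ℂ (fun z => f (expUnit z, v)) 0 := by
  induction hf using Algebra.adjoin_induction with
  | mem f hf =>
    rcases hf with (rfl | rfl) | ⟨ξ, rfl⟩
    · exact Complex.differentiable_exp (0 : ℂ)
    · simp only [Units.val_inv_eq_inv_val, expUnit, Units.val_mk0]
      exact (Complex.differentiable_exp (0 : ℂ)).inv (Complex.exp_ne_zero _)
    · exact differentiableAt_const (ξ v)
  | algebraMap c => exact differentiableAt_const c
  | add f g _ _ hf hg => exact hf.add hg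
  | mul f g _ _ hf hg => exact hf.mul hg

lemma coordRingProd_one_mem {f : ℂˣ × V → ℂ} (hf : f ∈ coordRingProd V) :
    (fun v => f (1, v)) ∈ coordRing V := by
  induction hf using Algebra.adjoin_induction with
  | mem f hf =>
    rcases hf with (rfl | rfl) | ⟨ξ, rfl⟩
    · exact (coordRing V).algebraMap_mem 1
    · simp only [inv_one, Units.val_one]
      exact (coordRing V).algebraMap_mem 1
    · exact Algebra.subset_adjoin ⟨ξ, rfl⟩
  | algebraMap c => exact (coordRing V).algebraMap_mem c
  | add f g _ _ hf hg => exact (coordRing V).add_mem hf hg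
  | mul f g _ _ hf hg => exact (coordRing V).mul_mem hf hg

lemma deriv_mul_expUnit {f g : ℂˣ × V → ℂ} (hf : f ∈ coordRingProd V) (hg : g ∈ coordRingProd V)
    (v : V) : deriv (fun z => (f * g) (expUnit z, v)) 0 =
      deriv (fun z => f (expUnit z, v)) 0 * g (1, v) +
        f (1, v) * deriv (fun z => g (expUnit z, v)) 0 := by
  have h := deriv_mul (coordRingProd_differentiableAt hf v) (coordRingProd_differentiableAt hg v)
  rw [expUnit_zero] at h
  exact h

/-- The ring consists of functions, so the derivative at `t = 1` is taken analytically along `t =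
exp z`. It is constant in `v` for `t` and `t⁻¹` and zero for linear forms on `V`; the Leibniz rule
does the rest. -/
lemma coordRingProd_deriv_mem {f : ℂˣ × V → ℂ} (hf : f ∈ coordRingProd V) :
    (fun v => deriv (fun z => f (expUnit z, v)) 0) ∈ coordRing V := by
  induction hf using Algebra.adjoin_induction with
  | mem f hf =>
    rcases hf with (rfl | rfl) | ⟨ξ, rfl⟩
    · exact (coordRing V).algebraMap_mem (deriv (fun z => ((expUnit z : ℂˣ) : ℂ)) 0)
    · exact (coordRing V).algebraMap_mem (deriv (fun z => (((expUnit z)⁻¹ : ℂˣ) : ℂ)) 0)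
    · simp only [deriv_const]
      exact (coordRing V).zero_mem
  | algebraMap c =>
    have : (fun v : V => deriv (fun z => algebraMap ℂ (ℂˣ × V → ℂ) c (expUnit z, v)) 0) = 0 := by
      refine _root_.funext fun v => ?_
      exact deriv_const _ _
    rw [this]
    exact (coordRing V).zero_mem
  | add f g hf hg hf' hg' =>
    have : (fun v => deriv (fun z => (f + g) (expUnit z, v)) 0) =
        (fun v => deriv (fun z => f (expUnit z, v)) 0) +
          fun v => deriv (fun z => g (expUnit z, v)) 0 := by
      refine _root_.funext fun v => ?_
      exact deriv_add (coordRingProd_differentiableAt hf v) (coordRingProd_differentiableAt hg v)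
    rw [this]
    exact (coordRing V).add_mem hf' hg'
  | mul f g hf hg hf' hg' =>
    have : (fun v => deriv (fun z => (f * g) (expUnit z, v)) 0) =
        (fun v => deriv (fun z => f (expUnit z, v)) 0) * (fun v => g (1, v)) +
          (fun v => f (1, v)) * fun v => deriv (fun z => g (expUnit z, v)) 0 :=
      _root_.funext fun v => deriv_mul_expUnit hf hg v
    rw [this]
    exact (coordRing V).add_mem ((coordRing V).mul_mem hf' (coordRingProd_one_mem hg))
      ((coordRing V).mul_mem (coordRingProd_one_mem hf) hg')

variable (V) in
/-- The restriction of a regular function on `ℂˣ × V` to the first order neighbourhood of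
`{1} × V`. -/
def restrictTangent : coordRingProd V →ₐ[ℂ] DualNumber (coordRing V) where
  toFun f := TrivSqZeroExt.inl ⟨_, coordRingProd_one_mem f.2⟩ +
    TrivSqZeroExt.inr ⟨_, coordRingProd_deriv_mem f.2⟩
  map_one' := by
    refine TrivSqZeroExt.ext ?_ ?_
    · simp only [TrivSqZeroExt.fst_add, TrivSqZeroExt.fst_inl, TrivSqZeroExt.fst_inr, add_zero,
        TrivSqZeroExt.fst_one]
      rfl
    · simp only [TrivSqZeroExt.snd_add, TrivSqZeroExt.snd_inl, TrivSqZeroExt.snd_inr, zero_add,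
        TrivSqZeroExt.snd_one]
      exact Subtype.ext (_root_.funext fun v => deriv_const _ _)
  map_zero' := by
    refine TrivSqZeroExt.ext ?_ ?_
    · simp only [TrivSqZeroExt.fst_add, TrivSqZeroExt.fst_inl, TrivSqZeroExt.fst_inr, add_zero,
        TrivSqZeroExt.fst_zero]
      rfl
    · simp only [TrivSqZeroExt.snd_add, TrivSqZeroExt.snd_inl, TrivSqZeroExt.snd_inr, zero_add,
        TrivSqZeroExt.snd_zero]
      exact Subtype.ext (_root_.funext fun v => deriv_const _ _)
  map_add' f g := by
    refine TrivSqZeroExt.ext ?_ ?_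
    · simp only [TrivSqZeroExt.fst_add, TrivSqZeroExt.fst_inl, TrivSqZeroExt.fst_inr, add_zero]
      rfl
    · simp only [TrivSqZeroExt.snd_add, TrivSqZeroExt.snd_inl, TrivSqZeroExt.snd_inr, zero_add]
      exact Subtype.ext (_root_.funext fun v => deriv_add (coordRingProd_differentiableAt f.2 v)
        (coordRingProd_differentiableAt g.2 v))
  map_mul' f g := by
    refine TrivSqZeroExt.ext ?_ ?_
    · simp only [TrivSqZeroExt.fst_mul, TrivSqZeroExt.fst_add, TrivSqZeroExt.fst_inl,
        TrivSqZeroExt.fst_inr, add_zero]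
      rfl
    · simp only [TrivSqZeroExt.snd_mul, TrivSqZeroExt.snd_add, TrivSqZeroExt.snd_inl,
        TrivSqZeroExt.snd_inr, zero_add, TrivSqZeroExt.fst_add, TrivSqZeroExt.fst_inl,
        TrivSqZeroExt.fst_inr, add_zero, smul_eq_mul, MulOpposite.smul_eq_mul_unop,
        MulOpposite.unop_op]
      refine Subtype.ext (_root_.funext fun v => (deriv_mul_expUnit f.2 g.2 v).trans ?_)
      rw [add_comm]
      rfl
  commutes' c := by
    refine TrivSqZeroExt.ext ?_ ?_
    · simp only [TrivSqZeroExt.fst_add, TrivSqZeroExt.fst_inl, TrivSqZeroExt.fst_inr, add_zero]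
      rfl
    · simp only [TrivSqZeroExt.snd_add, TrivSqZeroExt.snd_inl, TrivSqZeroExt.snd_inr, zero_add]
      exact Subtype.ext (_root_.funext fun v => deriv_const _ _)

/-- The derivatives of `exp z` and `exp (-z)` at `0` give the signs in `arcDerivation`. -/
lemma IsWeightBasis.restrictTangent_actionPullback {ι κ : Type} {b : Module.Basis (ι ⊕ κ) ℂ V}
    {ρ : Representation ℂ ℂˣ V} (hb : IsWeightBasis b ρ) (hρ : IsAlgebraicRep ρ) (c : ι ⊕ κ) :
    restrictTangent V (actionPullback ρ hρ (coordFun b c)) = TrivSqZeroExt.inl (coordFun b c) +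
      TrivSqZeroExt.inr (Sum.elim (fun _ => (1 : ℂ)) (fun _ => -1) c • coordFun b c) := by
  have h1 : ∀ (t : ℂˣ) (v : V), (actionPullback ρ hρ (coordFun b c) : ℂˣ × V → ℂ) (t, v) =
      Sum.elim (fun _ => (t : ℂ)) (fun _ => (t : ℂ)⁻¹) c * b.repr v c :=
    fun t v => hb.repr_apply t v c
  refine TrivSqZeroExt.ext ?_ ?_
  · change _ + 0 = _ + 0
    rw [add_zero, add_zero]
    refine Subtype.ext (_root_.funext fun v => (h1 1 v).trans ?_)
    change _ = b.repr v c
    rcases c with c | c <;> simp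
  · change 0 + _ = 0 + _
    rw [zero_add, zero_add]
    refine Subtype.ext (_root_.funext fun v => ?_)
    change deriv (fun z => (actionPullback ρ hρ (coordFun b c) : ℂˣ × V → ℂ) (expUnit z, v)) 0 =
      Sum.elim (fun _ => (1 : ℂ)) (fun _ => -1) c * b.repr v c
    simp only [h1]
    rcases c with c | c
    · simp only [Sum.elim_inl, expUnit, Units.val_mk0]
      rw [deriv_mul_const Complex.differentiable_exp.differentiableAt, Complex.deriv_exp,
        Complex.exp_zero]
    · simp only [Sum.elim_inr, expUnit, Units.val_mk0, ← Complex.exp_neg]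
      have h2 : HasDerivAt (fun z : ℂ => Complex.exp (-z) * b.repr v (Sum.inr c))
          (Complex.exp (-0) * -1 * b.repr v (Sum.inr c)) 0 :=
        ((hasDerivAt_neg (0 : ℂ)).cexp).mul_const _
      rw [h2.deriv]
      simp

end Tangent

/-! ### Arc invariants are killed by the vector fields `D_m` -/

section Infinitesimal

/-- The homomorphism `f ↦ f + ε D f` to the dual numbers attached to a derivation `D`. -/
def dualNumberHom {A : Type*} [CommRing A] [Algebra ℂ A] (D : Derivation ℂ A A) :
    A →ₐ[ℂ] DualNumber A where
  toFun f := TrivSqZeroExt.inl f + TrivSqZeroExt.inr (D f)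
  map_one' := by simp
  map_zero' := by simp
  map_add' f g := by
    refine TrivSqZeroExt.ext ?_ ?_ <;> simp
  map_mul' f g := by
    refine TrivSqZeroExt.ext ?_ ?_
    · simp
    · simp [mul_comm]
  commutes' c := by
    rw [TrivSqZeroExt.algebraMap_eq_inl', Derivation.map_algebraMap, TrivSqZeroExt.inr_zero, add_zero]

variable {V : Type u} [AddCommGroup V] [Module ℂ V] {ι κ : Type} [Fintype ι] [Fintype κ]
  (b : Module.Basis (ι ⊕ κ) ℂ V)

/-- The extension of the universal arc of `V` to dual numbers which sends `ε` to `ε t ^ m`. -/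
def dualArc (m : ℕ) : DualNumber (coordRing V) →ₐ[ℂ]
    PowerSeries (DualNumber (MvPolynomial ((ι ⊕ κ) × ℕ) ℂ)) :=
  DualNumber.lift ⟨((PowerSeries.mapAlgHom (TrivSqZeroExt.inlAlgHom ℂ _ _)).comp (coordArc b),
    PowerSeries.C DualNumber.eps * PowerSeries.X ^ m), by
      rw [mul_mul_mul_comm, ← map_mul, DualNumber.eps_mul_eps, map_zero, zero_mul],
    fun _ => Commute.all _ _⟩

lemma dualArc_apply (m : ℕ) (r : DualNumber (coordRing V)) :
    dualArc b m r = PowerSeries.map (TrivSqZeroExt.inlAlgHom ℂ _ _).toRingHom (coordArc b r.fst) +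
      PowerSeries.map (TrivSqZeroExt.inlAlgHom ℂ _ _).toRingHom (coordArc b r.snd) *
        (PowerSeries.C DualNumber.eps * PowerSeries.X ^ m) :=
  DualNumber.lift_apply_apply _ _

/-- The tangent vector `1 + ε t ^ m` of the arc space of the torus, as a morphism to the arc space
of `ℂˣ × V`. -/
def arcTangent (m : ℕ) : ArcAlgebra ℂ (coordRingProd V) →ₐ[ℂ]
    DualNumber (MvPolynomial ((ι ⊕ κ) × ℕ) ℂ) :=
  ArcAlgebra.lift ((dualArc b m).comp (restrictTangent V))

lemma arcTangent_map_coeff (m : ℕ) (φ : coordRing V →ₐ[ℂ] coordRingProd V) (r : coordRing V)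
    (n : ℕ) : arcTangent b m (ArcAlgebra.map φ (PowerSeries.coeff n
      (ArcAlgebra.universalArc ℂ (coordRing V) r))) =
      PowerSeries.coeff n (dualArc b m (restrictTangent V (φ r))) := by
  rw [ArcAlgebra.map_coeff_universalArc, ArcAlgebra.coeff_universalArc, arcTangent,
    ArcAlgebra.lift_mk_X, AlgHom.comp_apply]

variable {b} {ρ : Representation ℂ ℂˣ V} (hb : IsWeightBasis b ρ)

lemma arcTangent_map_sndPullback (m : ℕ) (f : ArcAlgebra ℂ (coordRing V)) :
    arcTangent b m (ArcAlgebra.map (sndPullback V) f) = TrivSqZeroExt.inl (arcCoord b f) := by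
  have h : (arcTangent b m).comp (ArcAlgebra.map (sndPullback V)) =
      (TrivSqZeroExt.inlAlgHom ℂ _ _).comp (arcCoord b) := by
    refine arcAlgebra_algHom_ext b fun c n => ?_
    rw [AlgHom.comp_apply, arcTangent_map_coeff, AlgHom.comp_apply, arcCoord_coeff_universalArc]
    have h1 : restrictTangent V (sndPullback V (coordFun b c)) =
        TrivSqZeroExt.inl (coordFun b c) := by
      refine TrivSqZeroExt.ext ?_ ?_
      · change _ + 0 = _
        rw [add_zero]
        rfl
      · change 0 + _ = _
        rw [zero_add]
        exact Subtype.ext (_root_.funext fun v => deriv_const (0 : ℂ) (b.repr v c))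
    rw [h1, dualArc_apply, TrivSqZeroExt.fst_inl, TrivSqZeroExt.snd_inl, map_zero, map_zero,
      zero_mul, add_zero, PowerSeries.coeff_map]
    rfl
  exact DFunLike.congr_fun h f

include hb

lemma IsWeightBasis.arcTangent_map_actionPullback (hρ : IsAlgebraicRep ρ) (m : ℕ)
    (f : ArcAlgebra ℂ (coordRing V)) :
    arcTangent b m (ArcAlgebra.map (actionPullback ρ hρ) f) =
      dualNumberHom (arcDerivation m) (arcCoord b f) := by
  have h : (arcTangent b m).comp (ArcAlgebra.map (actionPullback ρ hρ)) =
      (dualNumberHom (arcDerivation m)).comp (arcCoord b) := by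
    refine arcAlgebra_algHom_ext b fun c n => ?_
    rw [AlgHom.comp_apply, arcTangent_map_coeff, AlgHom.comp_apply, arcCoord_coeff_universalArc,
      hb.restrictTangent_actionPullback hρ, dualArc_apply]
    simp only [TrivSqZeroExt.fst_add, TrivSqZeroExt.fst_inl, TrivSqZeroExt.fst_inr, add_zero,
      TrivSqZeroExt.snd_add, TrivSqZeroExt.snd_inl, TrivSqZeroExt.snd_inr, zero_add, map_smul,
      coordArc_coordFun, map_add]
    rw [← mul_assoc, PowerSeries.coeff_mul_X_pow', coordSeries, PowerSeries.coeff_map,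
      PowerSeries.coeff_mk]
    change _ = TrivSqZeroExt.inl (X (c, n)) + TrivSqZeroExt.inr (arcDerivation m (X (c, n)))
    rw [arcDerivation, mkDerivation_X]
    congr 1
    split_ifs with h
    · rw [PowerSeries.coeff_mul_C, PowerSeries.coeff_map, PowerSeries.coeff_smul,
        PowerSeries.coeff_mk]
      exact TrivSqZeroExt.ext (by simp) (by simp)
    · simp
  exact DFunLike.congr_fun h f

/-- Restricted to the tangent vector `1 + ε t ^ m`, the action gives `f + ε D_m f` and the
projection gives `f`; invariance equates the two. -/
theorem IsWeightBasis.arcDerivation_eq_zero (hρ : IsAlgebraicRep ρ)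
    {f : ArcAlgebra ℂ (coordRing V)} (hf : f ∈ arcInvariants ρ hρ) (m : ℕ) :
    arcDerivation m (arcCoord b f) = 0 := by
  have h := congrArg (arcTangent b m) ((AlgHom.mem_equalizer _ _ _).1 hf)
  rw [hb.arcTangent_map_actionPullback hρ, arcTangent_map_sndPullback] at h
  have h1 := congrArg TrivSqZeroExt.snd h
  change 0 + _ = (0 : MvPolynomial ((ι ⊕ κ) × ℕ) ℂ) at h1
  rwa [zero_add] at h1

end Infinitesimal

end

/-! ### Decomposition into weight spaces -/

section Weights

variable {V : Type u} [AddCommGroup V] [Module ℂ V]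

/-- The subspace of vectors of weight `m`. -/
def weightSpace (ρ : Representation ℂ ℂˣ V) (m : ℤ) : Submodule ℂ V where
  carrier := {v | ∀ t : ℂˣ, ρ t v = ((t ^ m : ℂˣ) : ℂ) • v}
  add_mem' hv hw t := by rw [map_add, hv t, hw t, smul_add]
  zero_mem' t := by rw [map_zero, smul_zero]
  smul_mem' c v hv t := by rw [map_smul, hv t, smul_comm]

lemma coordRingProd_mem_span_zpow {f : ℂˣ × V → ℂ} (hf : f ∈ coordRingProd V) (v : V) :
    (fun t => f (t, v)) ∈
      Submodule.span ℂ (Set.range fun (m : ℤ) (t : ℂˣ) => ((t ^ m : ℂˣ) : ℂ)) := by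
  have hconst : ∀ c : ℂ, (fun _ : ℂˣ => c) ∈
      Submodule.span ℂ (Set.range fun (m : ℤ) (t : ℂˣ) => ((t ^ m : ℂˣ) : ℂ)) := fun c => by
    have h := Submodule.smul_mem _ c (Submodule.subset_span (R := ℂ)
      (Set.mem_range_self (f := fun (m : ℤ) (t : ℂˣ) => ((t ^ m : ℂˣ) : ℂ)) 0))
    convert h using 1
    funext t
    simp
  induction hf using Algebra.adjoin_induction with
  | mem f hf =>
    rcases hf with (rfl | rfl) | ⟨ξ, rfl⟩
    · exact Submodule.subset_span ⟨1, by funext t; simp⟩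
    · exact Submodule.subset_span ⟨-1, by funext t; simp⟩
    · exact hconst (ξ v)
  | algebraMap c => exact hconst c
  | add f g _ _ hf hg => exact add_mem hf hg
  | mul f g _ _ hf hg =>
    have h := Submodule.mul_mem_mul hf hg
    rw [Submodule.span_mul_span] at h
    refine Submodule.span_mono ?_ h
    rintro _ ⟨_, ⟨m, rfl⟩, _, ⟨n, rfl⟩, rfl⟩
    exact ⟨m + n, by funext t; simp [zpow_add]⟩

variable (V) in
/-- The function `t ↦ ∑ₘ tᵐ wₘ` on `ℂˣ` with values in `V`. -/
def laurentFun : (ℤ →₀ V) →ₗ[ℂ] (ℂˣ → V) :=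
  Finsupp.lsum ℂ fun m => LinearMap.pi fun t => ((t ^ m : ℂˣ) : ℂ) • LinearMap.id

lemma laurentFun_apply (w : ℤ →₀ V) (t : ℂˣ) :
    laurentFun V w t = ∑ m ∈ w.support, ((t ^ m : ℂˣ) : ℂ) • w m := by
  rw [laurentFun, Finsupp.lsum_apply, Finsupp.sum, Finset.sum_apply]
  rfl

lemma laurentFun_apply_of_support_subset {w : ℤ →₀ V} {T : Finset ℤ} (h : w.support ⊆ T)
    (t : ℂˣ) : laurentFun V w t = ∑ m ∈ T, ((t ^ m : ℂˣ) : ℂ) • w m := by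
  rw [laurentFun_apply]
  refine Finset.sum_subset h fun m _ hm => ?_
  rw [Finsupp.notMem_support_iff.1 hm, smul_zero]

/-- Dedekind's independence of characters, applied after each linear form on `V`; the characters `t
↦ t ^ m` differ already at `t = 2`. -/
lemma laurentFun_injective : Function.Injective (laurentFun V) := by
  rw [injective_iff_map_eq_zero]
  intro w hw
  let χ : ℤ → (ℂˣ →* ℂ) := fun m => (Units.coeHom ℂ).comp (zpowGroupHom m)
  have hχ : Function.Injective χ := by
    intro m n h
    have h1 := DFunLike.congr_fun h (Units.mk0 2 two_ne_zero)
    have h2 : (2 : ℂ) ^ m = 2 ^ n := by simpa [χ] using h1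
    have h3 : (2 : ℝ) ^ m = 2 ^ n := by
      have h4 : (((2 : ℝ) ^ m : ℝ) : ℂ) = ((2 ^ n : ℝ) : ℂ) := by
        push_cast
        exact h2
      exact_mod_cast h4
    exact zpow_right_injective₀ two_pos (by norm_num) h3
  have hli := (linearIndependent_monoidHom ℂˣ ℂ).comp χ hχ
  rw [linearIndependent_iff'] at hli
  ext m
  by_cases hm : m ∈ w.support
  swap
  · exact Finsupp.notMem_support_iff.1 hm
  rw [Finsupp.zero_apply, ← Module.forall_dual_apply_eq_zero_iff ℂ]
  intro ξ
  refine hli w.support (fun m => ξ (w m)) (funext fun t => ?_) m hm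
  have h := congrArg ξ (congrFun hw t)
  rw [laurentFun_apply, map_sum] at h
  rw [Finset.sum_apply]
  simpa [χ, mul_comm] using h

lemma exists_laurentFun_eq [FiniteDimensional ℂ V] {ρ : Representation ℂ ℂˣ V}
    (hρ : IsAlgebraicRep ρ) (v : V) : ∃ w, laurentFun V w = fun t => ρ t v := by
  let b := Module.finBasis ℂ V
  suffices h : ∀ g ∈ Submodule.span ℂ (Set.range fun (m : ℤ) (t : ℂˣ) => ((t ^ m : ℂˣ) : ℂ)),
      ∀ u : V, (fun t => g t • u) ∈ LinearMap.range (laurentFun V) by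
    have h1 : (fun t => ρ t v) = ∑ k, fun t => b.coord k (ρ t v) • b k := by
      funext t
      rw [Finset.sum_apply]
      exact (b.sum_repr (ρ t v)).symm
    rw [h1]
    exact sum_mem fun k _ => h _ (coordRingProd_mem_span_zpow (hρ (b.coord k)) v) (b k)
  intro g hg u
  induction hg using Submodule.span_induction with
  | mem g hg =>
    obtain ⟨m, rfl⟩ := hg
    refine ⟨Finsupp.single m u, funext fun t => ?_⟩
    rw [laurentFun, Finsupp.lsum_single]
    rfl
  | zero =>
    simp only [Pi.zero_apply, zero_smul]
    exact zero_mem _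
  | add f g _ _ hf hg =>
    simp only [Pi.add_apply, add_smul]
    exact add_mem hf hg
  | smul a g _ hg =>
    simp only [Pi.smul_apply, smul_assoc]
    exact Submodule.smul_mem _ a hg

/-- Expand `ρ (s * t) v = ρ s (ρ t v)` in two ways and compare the coefficients of `t ^ m`. -/
lemma mem_weightSpace_of_laurentFun_eq {ρ : Representation ℂ ℂˣ V} {v : V} {w : ℤ →₀ V}
    (hw : laurentFun V w = fun t => ρ t v) (m : ℤ) : w m ∈ weightSpace ρ m := by
  intro s
  have h : Finsupp.mapRange.linearMap (ρ s) w =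
      Finsupp.onFinset w.support (fun m => ((s ^ m : ℂˣ) : ℂ) • w m) fun m hm => by
        rw [Finsupp.mem_support_iff]
        rintro h0
        exact hm (by rw [h0, smul_zero]) := by
    refine laurentFun_injective (funext fun t => ?_)
    have h1 := congrFun hw (s * t)
    rw [laurentFun_apply, map_mul, Module.End.mul_apply, ← congrFun hw t, laurentFun_apply,
      map_sum] at h1
    rw [laurentFun_apply_of_support_subset
      (show (Finsupp.mapRange.linearMap (ρ s) w).support ⊆ w.support from
        Finsupp.support_mapRange (hf := map_zero (ρ s))),
      laurentFun_apply_of_support_subset (T := w.support) Finsupp.support_onFinset_subset]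
    calc _ = ∑ m ∈ w.support, ρ s (((t ^ m : ℂˣ) : ℂ) • w m) :=
          Finset.sum_congr rfl fun m _ => (map_smul (ρ s) _ _).symm
      _ = _ := h1.symm
      _ = _ := Finset.sum_congr rfl fun m _ => by
          rw [Finsupp.onFinset_apply, smul_smul, mul_zpow, mul_comm, Units.val_mul]
  exact DFunLike.congr_fun h m

lemma exists_isWeightBasis [FiniteDimensional ℂ V] {ρ : Representation ℂ ℂˣ V}
    (hρ : IsAlgebraicRep ρ) (hw : ∀ m : ℤ, IsWeight ρ m → m = 1 ∨ m = -1) :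
    ∃ (m n : ℕ) (b : Module.Basis (Fin m ⊕ Fin n) ℂ V), IsWeightBasis b ρ := by
  have hcompl : IsCompl (weightSpace ρ 1) (weightSpace ρ (-1)) := by
    constructor
    · rw [Submodule.disjoint_def]
      intro v h1 h2
      have h3 := (h1 (Units.mk0 2 two_ne_zero)).symm.trans (h2 (Units.mk0 2 two_ne_zero))
      rw [← sub_eq_zero, ← sub_smul, smul_eq_zero] at h3
      refine h3.resolve_left ?_
      norm_num
    · rw [codisjoint_iff, eq_top_iff]
      rintro v -
      obtain ⟨w, h⟩ := exists_laurentFun_eq hρ v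
      -- At `t = 1` the Laurent expansion of `ρ t v` writes `v` as a sum of weight vectors.
      have h1 := congrFun h 1
      rw [laurentFun_apply, map_one, Module.End.one_apply] at h1
      rw [← h1]
      refine sum_mem fun m hm => ?_
      have h2 := mem_weightSpace_of_laurentFun_eq h m
      rw [one_zpow, Units.val_one, one_smul]
      rcases hw m ⟨w m, Finsupp.mem_support_iff.1 hm, h2⟩ with rfl | rfl
      · exact Submodule.mem_sup_left h2
      · exact Submodule.mem_sup_right h2
  refine ⟨_, _, ((Module.finBasis ℂ (weightSpace ρ 1)).prod
    (Module.finBasis ℂ (weightSpace ρ (-1)))).map (Submodule.prodEquivOfIsCompl _ _ hcompl),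
    fun i t => ?_, fun j t => ?_⟩
  · have h := (Module.finBasis ℂ (weightSpace ρ 1) i).2 t
    simpa using h
  · have h := (Module.finBasis ℂ (weightSpace ρ (-1)) j).2 t
    simpa using h

end Weights

/-! ### Conclusion -/

section Main

open MvPolynomial

variable {V : Type u} [AddCommGroup V] [Module ℂ V] {ι κ : Type} [Fintype ι] [Fintype κ]
  {b : Module.Basis (ι ⊕ κ) ℂ V} {ρ : Representation ℂ ℂˣ V} (hb : IsWeightBasis b ρ)
include hb

lemma IsWeightBasis.mem_range_arcPullback
    {f : MvPolynomial ((ι ⊕ κ) × ℕ) ℂ} (hf : ∀ m, arcDerivation m f = 0) :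
    ∃ s, arcCoord b (arcPullback ρ s) = f :=
  mem_range_of_arcDerivation_eq_zero hb.map_universalArc_invariant hf

theorem IsWeightBasis.arcQuotientPullback_bijective (hρ : IsAlgebraicRep ρ) :
    Function.Bijective (arcQuotientPullback ρ hρ) := by
  refine ⟨fun s s' h => ?_, fun f => ?_⟩
  · exact hb.arcCoord_arcPullback_injective (congrArg (arcCoord b) (congrArg Subtype.val h))
  · obtain ⟨s, hs⟩ := hb.mem_range_arcPullback (hb.arcDerivation_eq_zero hρ f.2)
    exact ⟨s, Subtype.ext (arcCoord_injective b hs)⟩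

theorem IsWeightBasis.isDomain : IsDomain (ArcAlgebra ℂ (invariants ρ)) :=
  hb.arcCoord_arcPullback_injective.isDomain ((arcCoord b).comp (arcPullback ρ)).toRingHom

/-- An integral fraction `r / s` becomes a polynomial `h` with `h * p s = p r`. Since `D_m` kills `p
s` and `p r`, it kills `h`, so `h` comes from `S`. -/
theorem IsWeightBasis.isIntegrallyClosed (hρ : IsAlgebraicRep ρ) :
    IsIntegrallyClosed (ArcAlgebra ℂ (invariants ρ)) := by
  have := hb.isDomain
  set p := ((arcCoord b).comp (arcPullback ρ)).toRingHom with hp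
  have hpinj : Function.Injective p := hb.arcCoord_arcPullback_injective
  have hpD : ∀ s m, arcDerivation m (p s) = 0 := fun s m =>
    hb.arcDerivation_eq_zero hρ (arcPullback_mem ρ hρ s) m
  rw [isIntegrallyClosed_iff (FractionRing (ArcAlgebra ℂ (invariants ρ)))]
  intro x hx
  obtain ⟨r, s, hs, rfl⟩ := IsFractionRing.div_surjective (A := ArcAlgebra ℂ (invariants ρ)) x
  have hs0 : s ≠ 0 := nonZeroDivisors.ne_zero hs
  set ψ : FractionRing (ArcAlgebra ℂ (invariants ρ)) →+*
    FractionRing (MvPolynomial ((ι ⊕ κ) × ℕ) ℂ) := IsFractionRing.map hpinj with hψ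
  have hψa : ∀ a, ψ (algebraMap _ _ a) = algebraMap _ _ (p a) := fun a =>
    IsLocalization.map_eq _ a
  have hint := hx.map_of_comp_eq p ψ (RingHom.ext fun a => (hψa a).symm)
  obtain ⟨h, hh⟩ := IsIntegrallyClosed.algebraMap_eq_of_integral hint
  have hps : p s ≠ 0 := (map_ne_zero_iff p hpinj).2 hs0
  have h1 : h * p s = p r := by
    apply IsFractionRing.injective (MvPolynomial ((ι ⊕ κ) × ℕ) ℂ)
      (FractionRing (MvPolynomial ((ι ⊕ κ) × ℕ) ℂ))
    rw [map_mul, hh, map_div₀, hψa, hψa, div_mul_cancel₀]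
    exact (map_ne_zero_iff _ (IsFractionRing.injective _ _)).2 hps
  have h2 : ∀ m, arcDerivation m h = 0 := by
    intro m
    have h3 := congrArg (arcDerivation m) h1
    rw [Derivation.leibniz, hpD, hpD, smul_zero, zero_add, smul_eq_mul] at h3
    exact (mul_eq_zero.1 h3).resolve_left hps
  obtain ⟨a, ha⟩ := hb.mem_range_arcPullback h2
  refine ⟨a, ?_⟩
  rw [eq_div_iff ((map_ne_zero_iff _ (IsFractionRing.injective _ _)).2 hs0), ← map_mul]
  congr 1
  apply hpinj
  rw [map_mul, ← h1, ← ha]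
  rfl

end Main

end ArcSpace

end

theorem mainTheorem7 {V : Type*} [AddCommGroup V] [Module ℂ V] [FiniteDimensional ℂ V]
    (ρ : Representation ℂ ℂˣ V) (hρ : ArcSpace.IsAlgebraicRep ρ)
    (hw : ∀ m : ℤ, ArcSpace.IsWeight ρ m → m = 1 ∨ m = -1) :
    Function.Bijective (ArcSpace.arcQuotientPullback ρ hρ) ∧
      IsDomain (ArcSpace.ArcAlgebra ℂ (ArcSpace.invariants ρ)) ∧
      IsIntegrallyClosed (ArcSpace.ArcAlgebra ℂ (ArcSpace.invariants ρ)) := by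
  obtain ⟨m, n, b, hb⟩ := ArcSpace.exists_isWeightBasis hρ hw
  exact ⟨hb.arcQuotientPullback_bijective hρ, hb.isDomain, hb.isIntegrallyClosed hρ⟩
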